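/- Let $n\in\mathbb N$, $0<\alpha<\infty$, $1<s\le n/\alpha$. Let $G_\alpha=\mathcal F^{-1}[(1+|\cdot|^2)^{-\alpha/2}]$ be the Bessel kernel on $\mathbb R^n$ and, for $E\subseteq\mathbb R^n$, let $$\mathcal C(E)=\inf\{\|f\|_{L^s(\mathbb R^n)}^s:\ f\ge 0,\ G_\alpha*f\ge 1\text{ on }E\}$$ be the Bessel capacity. For $1<p,q<\infty$ and real measurable $f$ on $\mathbb R^n$ (functions equal almost everywhere are identified) put $$\|f\|_{L^{p,q}}=p^{1/q}\Big(\int_0^\infty|\{|f|>t\}|^{q/p}\,t^q\,\frac{dt}{t}\Big)^{1/q},\qquad \|f\|_{M^{p,q}}=\sup_K\frac{\|f\chi_K\|_{L^{p,q}}}{\mathcal C(K)^{1/q}},\qquad \|f\|_{\mathcal M^{p,q}}=\sup_K\frac{\|f\chi_K\|_{L^{p,q}}}{\mathcal C(K)^{1/p}},$$ where the suprema run over all compact $K\subseteq\mathbb R^n$ with $\mathcal C(K)\neq 0$, and let $M^{p,q}$, $\mathcal M^{p,q}$ be the spaces of all $f$ for which the respective quantity is finite. For such a space $X$, the Köthe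 dual $X'$ is the space of all measurable $f$ with $$\|f\|_{X'}=\sup\Big\{\int_{\mathbb R^n}|fg|\,dx:\ \|g\|_X\le 1\Big\}<\infty,$$ and $(X')^*$ is the space of continuous linear functionals on $X'$ with the operator norm. **Theorem 1.1.** Let $1<p<\infty$ and $1<q<\infty$. Then $$[(M^{p,q})']^*\approx M^{p,q},\qquad[(\mathcal M^{p,q})']^*\approx\mathcal M^{p,q}.$$ That is, for $X=M^{p,q}$ and for $X=\mathcal M^{p,q}$ there is a constant $c>0$ such that: for every $\mathcal L\in(X')^*$ there is a unique $g\in X$ with $$\mathcal L(f)=\int_{\mathbb R^n}f(x)g(x)\,dx\qquad\text{for all }f\in X'$$ (the integrals converging absolutely); and, conversely, every $g\in X$ defines by this formula an element $\mathcal L_g$ of $(X')^*$, with $c^{-1}\|g\|_X\le\|\mathcal L_g\|\le c\,\|g\|_X$. If $p=q$, the isomorphisms are isometric: $\|\mathcal L_g\|=\|g\|_X$ for every $g\in X$. -/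

import Mathlib

open MeasureTheory Set
open scoped ENNReal

/-! ### Bessel kernels and Bessel capacities on `ℝⁿ` -/

/-- The density `(t, x) ↦ Γ(α/2)⁻¹ t^(α/2 - 1) e^(-t) (4πt)^(-n/2) e^(-|x|²/(4t))`. -/
noncomputable def besselDensity (n : ℕ) (α : ℝ) (x : EuclideanSpace ℝ (Fin n)) (t : ℝ) : ℝ :=
  t ^ (α / 2 - 1) * Real.exp (-t) / Real.Gamma (α / 2) *
    ((4 * Real.pi * t) ^ (-(n : ℝ) / 2) * Real.exp (-‖x‖ ^ 2 / (4 * t)))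

/-- The Bessel kernel `G_α` on `ℝⁿ`, `α > 0`, as a function with values in `[0, ∞]`. It is the
nonnegative integrable function with Fourier transform `(1 + |ξ|²)^(-α/2)` in the angular frequency
`ξ`; see `integrable_besselKernel` and `fourier_besselKernel`, where Mathlib's normalization
`∫ f(x) e^(-2πi⟨x, w⟩) dx` means `ξ = 2πw`. -/
noncomputable def besselKernel (n : ℕ) (α : ℝ) (x : EuclideanSpace ℝ (Fin n)) : ℝ≥0∞ :=
  ∫⁻ t in Ioi (0 : ℝ), ENNReal.ofReal (besselDensity n α x t)

theorem besselDensity_nonneg {n : ℕ} {α : ℝ} (hα : 0 < α) (x : EuclideanSpace ℝ (Fin n)) {t : ℝ}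
    (ht : 0 < t) : 0 ≤ besselDensity n α x t := by
  have := Real.Gamma_pos_of_pos (half_pos hα)
  unfold besselDensity
  positivity

theorem measurable_besselDensity (n : ℕ) (α : ℝ) :
    Measurable (fun z : EuclideanSpace ℝ (Fin n) × ℝ => besselDensity n α z.1 z.2) := by
  unfold besselDensity
  fun_prop

theorem toReal_besselKernel {n : ℕ} {α : ℝ} (hα : 0 < α) (x : EuclideanSpace ℝ (Fin n)) :
    (besselKernel n α x).toReal = ∫ t in Ioi (0 : ℝ), besselDensity n α x t := by
  rw [integral_eq_lintegral_of_nonneg_ae]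
  · rfl
  · filter_upwards [ae_restrict_mem measurableSet_Ioi] with t ht
    exact besselDensity_nonneg hα x ht
  · exact ((measurable_besselDensity n α).comp (measurable_const.prodMk measurable_id)).aestronglyMeasurable

theorem fourier_heat (n : ℕ) {t : ℝ} (ht : 0 < t) (w : EuclideanSpace ℝ (Fin n)) :
    FourierTransform.fourier (fun x : EuclideanSpace ℝ (Fin n) =>
      (((4 * Real.pi * t) ^ (-(n : ℝ) / 2) * Real.exp (-‖x‖ ^ 2 / (4 * t)) : ℝ) : ℂ)) w =
      ((Real.exp (-((2 * Real.pi * ‖w‖) ^ 2 * t)) : ℝ) : ℂ) := by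
  have h4 : 0 < 4 * Real.pi * t := by positivity
  have hb : 0 < (((4 * t)⁻¹ : ℝ) : ℂ).re := by rw [Complex.ofReal_re]; positivity
  have key := fourier_gaussian_innerProductSpace hb w
  have h1 : (fun x : EuclideanSpace ℝ (Fin n) =>
      (((4 * Real.pi * t) ^ (-(n : ℝ) / 2) * Real.exp (-‖x‖ ^ 2 / (4 * t)) : ℝ) : ℂ)) =
      (((4 * Real.pi * t) ^ (-(n : ℝ) / 2) : ℝ) : ℂ) •
        (fun x => Complex.exp (-(((4 * t)⁻¹ : ℝ) : ℂ) * (‖x‖ : ℂ) ^ 2)) := by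
    funext x
    simp only [Pi.smul_apply, smul_eq_mul]
    push_cast
    congr 2
    field_simp
  rw [h1, Real.fourier_eq]
  simp only [Pi.smul_apply]
  rw [show (fun v => Real.fourierChar (-inner ℝ v w) •
      (((4 * Real.pi * t) ^ (-(n : ℝ) / 2) : ℝ) : ℂ) •
        Complex.exp (-(((4 * t)⁻¹ : ℝ) : ℂ) * (‖v‖ : ℂ) ^ 2)) = (fun v =>
      (((4 * Real.pi * t) ^ (-(n : ℝ) / 2) : ℝ) : ℂ) • (Real.fourierChar (-inner ℝ v w) •
        Complex.exp (-(((4 * t)⁻¹ : ℝ) : ℂ) * (‖v‖ : ℂ) ^ 2))) from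
      funext fun v => smul_comm _ _ _, integral_smul, ← Real.fourier_eq, key]
  have e1 : ((Real.pi : ℂ) / (((4 * t)⁻¹ : ℝ) : ℂ)) = ((4 * Real.pi * t : ℝ) : ℂ) := by
    push_cast; field_simp
  have e2 : ((Module.finrank ℝ (EuclideanSpace ℝ (Fin n)) : ℂ) / 2) = (((n : ℝ) / 2 : ℝ) : ℂ) := by
    simp
  rw [e1, e2, ← Complex.ofReal_cpow h4.le, smul_eq_mul, ← mul_assoc, ← Complex.ofReal_mul,
    ← Real.rpow_add h4]
  rw [show -(n : ℝ) / 2 + (n : ℝ) / 2 = 0 by ring, Real.rpow_zero]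
  push_cast
  rw [one_mul]
  congr 1
  field_simp
  ring

theorem integrable_heat (n : ℕ) {t : ℝ} (ht : 0 < t) :
    Integrable (fun x : EuclideanSpace ℝ (Fin n) =>
      (4 * Real.pi * t) ^ (-(n : ℝ) / 2) * Real.exp (-‖x‖ ^ 2 / (4 * t))) := by
  have hb : 0 < (((4 * t)⁻¹ : ℝ) : ℂ).re := by rw [Complex.ofReal_re]; positivity
  have := (GaussianFourier.integrable_cexp_neg_mul_sq_norm_add hb 0
    (0 : EuclideanSpace ℝ (Fin n))).norm
  refine Integrable.const_mul (this.congr (Filter.Eventually.of_forall fun x => ?_)) _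
  simp only [Complex.norm_exp]
  congr 1
  rw [show (-(((4 * t)⁻¹ : ℝ) : ℂ) * (‖x‖ : ℂ) ^ 2 +
    0 * ((inner ℝ (0 : EuclideanSpace ℝ (Fin n)) x : ℝ) : ℂ)) =
    ((-‖x‖ ^ 2 / (4 * t) : ℝ) : ℂ) by push_cast; field_simp; simp, Complex.ofReal_re]

theorem integral_heat (n : ℕ) {t : ℝ} (ht : 0 < t) :
    ∫ x : EuclideanSpace ℝ (Fin n),
      (4 * Real.pi * t) ^ (-(n : ℝ) / 2) * Real.exp (-‖x‖ ^ 2 / (4 * t)) = 1 := by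
  have h := fourier_heat n ht 0
  rw [Real.fourier_eq] at h
  simp only [inner_zero_right, neg_zero, AddChar.map_zero_eq_one, one_smul, norm_zero, mul_zero,
    ne_eq, OfNat.ofNat_ne_zero, not_false_eq_true, zero_pow, zero_mul, Real.exp_zero] at h
  rw [integral_complex_ofReal] at h
  exact_mod_cast h

theorem integrable_besselDensity (n : ℕ) {α : ℝ} (hα : 0 < α) :
    Integrable (fun z : EuclideanSpace ℝ (Fin n) × ℝ => besselDensity n α z.1 z.2)
      (volume.prod (volume.restrict (Ioi 0))) := by
  rw [integrable_prod_iff' (measurable_besselDensity n α).aestronglyMeasurable]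
  constructor
  · filter_upwards [ae_restrict_mem measurableSet_Ioi] with t ht
    exact (integrable_heat n ht).const_mul _
  · have : IntegrableOn (fun t : ℝ => Real.exp (-t) * t ^ (α / 2 - 1) / Real.Gamma (α / 2))
        (Ioi 0) := (Real.GammaIntegral_convergent (half_pos hα)).div_const _
    refine Integrable.congr this ?_
    filter_upwards [ae_restrict_mem measurableSet_Ioi] with t ht
    have : ∀ x : EuclideanSpace ℝ (Fin n), ‖besselDensity n α x t‖ = besselDensity n α x t :=
      fun x => Real.norm_of_nonneg (besselDensity_nonneg hα x ht)
    simp only [this]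
    unfold besselDensity
    rw [integral_const_mul, integral_heat n ht]
    ring

/-- `G_α` is integrable. -/
theorem integrable_besselKernel (n : ℕ) {α : ℝ} (hα : 0 < α) :
    Integrable (fun x : EuclideanSpace ℝ (Fin n) => (besselKernel n α x).toReal) := by
  simp only [toReal_besselKernel hα]
  exact (integrable_besselDensity n hα).integral_prod_left

/-- `G_α` has Fourier transform `(1 + |ξ|²)^(-α/2)` at the frequency `ξ = 2πw`. -/
theorem fourier_besselKernel (n : ℕ) {α : ℝ} (hα : 0 < α) (w : EuclideanSpace ℝ (Fin n)) :
    FourierTransform.fourier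
      (fun x : EuclideanSpace ℝ (Fin n) => ((besselKernel n α x).toReal : ℂ)) w =
      (((1 + (2 * Real.pi * ‖w‖) ^ 2) ^ (-α / 2) : ℝ) : ℂ) := by
  have hG := Real.Gamma_pos_of_pos (half_pos hα)
  rw [Real.fourier_eq]
  have h1 : ∀ v : EuclideanSpace ℝ (Fin n),
      Real.fourierChar (-inner ℝ v w) • ((besselKernel n α v).toReal : ℂ) =
      ∫ t in Ioi (0 : ℝ), Real.fourierChar (-inner ℝ v w) • ((besselDensity n α v t : ℝ) : ℂ) := by
    intro v
    rw [toReal_besselKernel hα, ← integral_complex_ofReal]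
    simp only [Circle.smul_def]
    rw [integral_smul]
  simp only [h1]
  rw [integral_integral_swap]
  · have h2 : ∀ t ∈ Ioi (0 : ℝ), (∫ v : EuclideanSpace ℝ (Fin n),
        Real.fourierChar (-inner ℝ v w) • ((besselDensity n α v t : ℝ) : ℂ)) =
        (((Real.Gamma (α / 2))⁻¹ *
          (t ^ (α / 2 - 1) * Real.exp (-((1 + (2 * Real.pi * ‖w‖) ^ 2) * t))) : ℝ) : ℂ) := by
      intro t ht
      have := fourier_heat n ht w
      rw [Real.fourier_eq] at this
      unfold besselDensity
      simp only [Complex.ofReal_mul (t ^ (α / 2 - 1) * Real.exp (-t) / Real.Gamma (α / 2)),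
        ← Complex.real_smul (x := t ^ (α / 2 - 1) * Real.exp (-t) / Real.Gamma (α / 2))]
      simp only [smul_comm _ (t ^ (α / 2 - 1) * Real.exp (-t) / Real.Gamma (α / 2))]
      rw [integral_smul, this, Complex.real_smul, ← Complex.ofReal_mul]
      congr 1
      rw [add_mul, neg_add, Real.exp_add, one_mul]
      ring
    rw [setIntegral_congr_fun measurableSet_Ioi h2, integral_complex_ofReal, integral_const_mul,
      Real.integral_rpow_mul_exp_neg_mul_Ioi (half_pos hα) (by positivity)]
    congr 1
    rw [one_div, Real.inv_rpow (by positivity), ← Real.rpow_neg (by positivity), neg_div]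
    field_simp
  · refine ((integrable_besselDensity n hα).ofReal (𝕜 := ℂ)).mono ?_ ?_
    · refine AEStronglyMeasurable.smul ?_
        (Complex.measurable_ofReal.comp (measurable_besselDensity n α)).aestronglyMeasurable
      exact (Continuous.aestronglyMeasurable (by fun_prop))
    · exact Filter.Eventually.of_forall fun z => by
        simp [Function.uncurry, Circle.norm_smul]

/-- The Bessel capacity `Cap_{α,s}(A)`: the infimum of `‖f‖_s^s` over nonnegative measurable `f`
whose Bessel potential `G_α * f` is at least `1` at every point of `A`. -/
noncomputable def besselCap (n : ℕ) (α s : ℝ) (A : Set (EuclideanSpace ℝ (Fin n))) : ℝ≥0∞ :=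
  ⨅ (f : EuclideanSpace ℝ (Fin n) → ℝ≥0∞) (_ : Measurable f)
    (_ : ∀ x ∈ A, 1 ≤ ∫⁻ y, besselKernel n α (x - y) * f y), ∫⁻ y, f y ^ s

/-! ### Lorentz quasi-norms and the two multiplier quasi-norms -/

/-- The Lorentz quasi-norm
`‖f‖_{L^{p,q}(μ)} = p^(1/q) (∫₀^∞ μ{|f| > t}^(q/p) t^q dt/t)^(1/q)`. -/
noncomputable def lorentzNorm {Ω : Type*} [MeasurableSpace Ω] (μ : Measure Ω) (p q : ℝ)
    (f : Ω → ℝ) : ℝ≥0∞ :=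
  ENNReal.ofReal p ^ (1 / q) *
    (∫⁻ t in Ioi (0 : ℝ), μ {x | t < |f x|} ^ (q / p) * ENNReal.ofReal (t ^ q / t)) ^ (1 / q)

/-- The quasi-norm `sup_K ‖f χ_K‖_{L^{p,q}} / Cap_{α,s}(K)^(1/r)` over all compact sets `K` of
nonzero capacity. -/
noncomputable def multiplierNorm (n : ℕ) (α s p q r : ℝ)
    (f : EuclideanSpace ℝ (Fin n) →ₘ[volume] ℝ) : ℝ≥0∞ :=
  ⨆ (K : Set (EuclideanSpace ℝ (Fin n))) (_ : IsCompact K) (_ : besselCap n α s K ≠ 0),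
    lorentzNorm volume p q (K.indicator f) / besselCap n α s K ^ (1 / r)

/-- The quasi-norm of `M^{p,q}`, with denominators `Cap_{α,s}(K)^(1/q)`. -/
noncomputable def normM (n : ℕ) (α s p q : ℝ) :
    (EuclideanSpace ℝ (Fin n) →ₘ[volume] ℝ) → ℝ≥0∞ :=
  multiplierNorm n α s p q q

/-- The quasi-norm of `𝓜^{p,q}`, with denominators `Cap_{α,s}(K)^(1/p)`. -/
noncomputable def normCalM (n : ℕ) (α s p q : ℝ) :
    (EuclideanSpace ℝ (Fin n) →ₘ[volume] ℝ) → ℝ≥0∞ :=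
  multiplierNorm n α s p q p

/-! ### Köthe duals

The space `X = {f : ρ f < ∞}` is given by its quasi-norm `ρ` on a.e. classes of measurable
functions. -/

section Koethe

variable {Ω : Type*} [MeasurableSpace Ω] {μ : Measure Ω}

/-- `‖f‖_{X'} = sup {∫ |f g| dμ : ‖g‖_X ≤ 1}`. -/
noncomputable def koetheNorm (ρ : (Ω →ₘ[μ] ℝ) → ℝ≥0∞) (f : Ω →ₘ[μ] ℝ) : ℝ≥0∞ :=
  ⨆ (g : Ω →ₘ[μ] ℝ) (_ : ρ g ≤ 1), ∫⁻ x, ENNReal.ofReal |f x * g x| ∂μ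

theorem koetheNorm_zero (ρ : (Ω →ₘ[μ] ℝ) → ℝ≥0∞) : koetheNorm ρ 0 = 0 := by
  simp only [koetheNorm, ENNReal.iSup_eq_zero]
  intro g _
  rw [lintegral_congr_ae (g := fun _ => 0), lintegral_zero]
  filter_upwards [AEEqFun.coeFn_zero (α := Ω) (β := ℝ) (μ := μ)] with x hx
  simp [hx]

theorem koetheNorm_add_le (ρ : (Ω →ₘ[μ] ℝ) → ℝ≥0∞) (f₁ f₂ : Ω →ₘ[μ] ℝ) :
    koetheNorm ρ (f₁ + f₂) ≤ koetheNorm ρ f₁ + koetheNorm ρ f₂ := by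
  refine iSup₂_le fun g hg => ?_
  calc ∫⁻ x, ENNReal.ofReal |(f₁ + f₂ : Ω →ₘ[μ] ℝ) x * g x| ∂μ
      ≤ ∫⁻ x, (ENNReal.ofReal |f₁ x * g x| + ENNReal.ofReal |f₂ x * g x|) ∂μ := by
        refine lintegral_mono_ae ?_
        filter_upwards [AEEqFun.coeFn_add f₁ f₂] with x hx
        rw [hx, Pi.add_apply, add_mul, ← ENNReal.ofReal_add (abs_nonneg _) (abs_nonneg _)]
        exact ENNReal.ofReal_le_ofReal (abs_add_le _ _)
    _ = ∫⁻ x, ENNReal.ofReal |f₁ x * g x| ∂μ + ∫⁻ x, ENNReal.ofReal |f₂ x * g x| ∂μ := by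
        refine lintegral_add_left' ?_ _
        have := (f₁.aemeasurable.mul g.aemeasurable)
        exact (this.abs).ennreal_ofReal
    _ ≤ koetheNorm ρ f₁ + koetheNorm ρ f₂ :=
        add_le_add (le_iSup₂_of_le g hg le_rfl) (le_iSup₂_of_le g hg le_rfl)

theorem koetheNorm_smul (ρ : (Ω →ₘ[μ] ℝ) → ℝ≥0∞) (c : ℝ) (f : Ω →ₘ[μ] ℝ) :
    koetheNorm ρ (c • f) = ENNReal.ofReal |c| * koetheNorm ρ f := by
  simp only [koetheNorm, ENNReal.mul_iSup]
  refine iSup_congr fun g => iSup_congr fun _ => ?_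
  rw [← lintegral_const_mul' _ _ ENNReal.ofReal_ne_top]
  refine lintegral_congr_ae ?_
  filter_upwards [AEEqFun.coeFn_smul c f] with x hx
  rw [hx, Pi.smul_apply, smul_eq_mul, mul_assoc, abs_mul, ENNReal.ofReal_mul (abs_nonneg _)]

/-- The subspace of all `f` with `‖f‖_{X'} < ∞`. -/
def koetheSubmodule (ρ : (Ω →ₘ[μ] ℝ) → ℝ≥0∞) : Submodule ℝ (Ω →ₘ[μ] ℝ) where
  carrier := {f | koetheNorm ρ f < ∞}
  zero_mem' := by simp [koetheNorm_zero]
  add_mem' := fun {a b} ha hb =>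
    (koetheNorm_add_le ρ a b).trans_lt (ENNReal.add_lt_top.2 ⟨ha, hb⟩)
  smul_mem' := fun c f hf => by
    change koetheNorm ρ (c • f) < ∞
    rw [koetheNorm_smul]
    exact ENNReal.mul_lt_top ENNReal.ofReal_lt_top hf

/-- The Köthe dual `X'` of `X = {f : ρ f < ∞}`, with the (semi)norm `‖·‖_{X'}`. -/
def KoetheDual (ρ : (Ω →ₘ[μ] ℝ) → ℝ≥0∞) : Type _ := koetheSubmodule ρ

noncomputable instance (ρ : (Ω →ₘ[μ] ℝ) → ℝ≥0∞) : AddCommGroup (KoetheDual ρ) :=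
  inferInstanceAs (AddCommGroup (koetheSubmodule ρ))

noncomputable instance (ρ : (Ω →ₘ[μ] ℝ) → ℝ≥0∞) : Module ℝ (KoetheDual ρ) :=
  inferInstanceAs (Module ℝ (koetheSubmodule ρ))

/-- The underlying a.e. class of an element of the Köthe dual. -/
def KoetheDual.toAEEqFun {ρ : (Ω →ₘ[μ] ℝ) → ℝ≥0∞} (f : KoetheDual ρ) : Ω →ₘ[μ] ℝ :=
  Subtype.val f

noncomputable instance (ρ : (Ω →ₘ[μ] ℝ) → ℝ≥0∞) : Norm (KoetheDual ρ) :=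
  ⟨fun f => (koetheNorm ρ f.toAEEqFun).toReal⟩

theorem KoetheDual.norm_def {ρ : (Ω →ₘ[μ] ℝ) → ℝ≥0∞} (f : KoetheDual ρ) :
    ‖f‖ = (koetheNorm ρ f.toAEEqFun).toReal := rfl

theorem KoetheDual.seminormedCore (ρ : (Ω →ₘ[μ] ℝ) → ℝ≥0∞) :
    SeminormedSpace.Core ℝ (KoetheDual ρ) where
  norm_nonneg f := ENNReal.toReal_nonneg
  norm_smul c f := by
    change (koetheNorm ρ (c • f.toAEEqFun)).toReal = |c| * (koetheNorm ρ f.toAEEqFun).toReal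
    rw [koetheNorm_smul, ENNReal.toReal_mul, ENNReal.toReal_ofReal (abs_nonneg _)]
  norm_triangle f g := by
    change (koetheNorm ρ (f.toAEEqFun + g.toAEEqFun)).toReal
      ≤ (koetheNorm ρ f.toAEEqFun).toReal + (koetheNorm ρ g.toAEEqFun).toReal
    have hf : koetheNorm ρ f.toAEEqFun < ∞ := f.2
    have hg : koetheNorm ρ g.toAEEqFun < ∞ := g.2
    rw [← ENNReal.toReal_add hf.ne hg.ne]
    exact ENNReal.toReal_mono (ENNReal.add_lt_top.2 ⟨hf, hg⟩).ne (koetheNorm_add_le ρ _ _)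

noncomputable instance (ρ : (Ω →ₘ[μ] ℝ) → ℝ≥0∞) : SeminormedAddCommGroup (KoetheDual ρ) :=
  SeminormedAddCommGroup.ofCore (KoetheDual.seminormedCore ρ)

noncomputable instance (ρ : (Ω →ₘ[μ] ℝ) → ℝ≥0∞) : NormedSpace ℝ (KoetheDual ρ) where
  norm_smul_le c f := ((KoetheDual.seminormedCore ρ).norm_smul c f).le

/-- The continuous linear functional `L` on `X'` is integration against `g`:
`f g` is integrable and `L f = ∫ f g dμ` for all `f ∈ X'`. -/
def Represents {ρ : (Ω →ₘ[μ] ℝ) → ℝ≥0∞} (L : StrongDual ℝ (KoetheDual ρ))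
    (g : Ω →ₘ[μ] ℝ) : Prop :=
  ∀ f : KoetheDual ρ, Integrable (fun x => f.toAEEqFun x * g x) μ ∧
    L f = ∫ x, f.toAEEqFun x * g x ∂μ

/-- `(X')* ≈ Y` with constant `c`, where `X` and `Y` are given by the quasi-norms `ρ` and `σ`:
every continuous linear functional on `X'` is integration against a unique `g ∈ Y`, every `g ∈ Y`
induces such a functional `L`, and its operator norm satisfies `c⁻¹ ‖g‖_Y ≤ ‖L‖ ≤ c ‖g‖_Y`.
For `c = 1` this says that the isomorphism is isometric. -/
def KoetheDualIso (ρ σ : (Ω →ₘ[μ] ℝ) → ℝ≥0∞) (c : ℝ) : Prop :=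
  (∀ L : StrongDual ℝ (KoetheDual ρ), ∃! g : Ω →ₘ[μ] ℝ, σ g < ∞ ∧ Represents L g) ∧
  ∀ g : Ω →ₘ[μ] ℝ, σ g < ∞ → ∃ L : StrongDual ℝ (KoetheDual ρ), Represents L g ∧
    c⁻¹ * (σ g).toReal ≤ ‖L‖ ∧ ‖L‖ ≤ c * (σ g).toReal

end Koethe

open Filter Topology

section DualNorm

variable {Ω : Type*} [MeasurableSpace Ω] {μ : Measure Ω}

/-- The Köthe dual norm of a function with values in `[0, ∞]`. -/
noncomputable def dualNorm (ρ : (Ω →ₘ[μ] ℝ) → ℝ≥0∞) (F : Ω → ℝ≥0∞) : ℝ≥0∞ :=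
  ⨆ (g : Ω →ₘ[μ] ℝ) (_ : ρ g ≤ 1), ∫⁻ x, F x * ‖g x‖ₑ ∂μ

variable {ρ : (Ω →ₘ[μ] ℝ) → ℝ≥0∞}

theorem ofReal_abs_mul_eq_enorm (a b : ℝ) : ENNReal.ofReal |a * b| = ‖a‖ₑ * ‖b‖ₑ := by
  rw [← Real.enorm_eq_ofReal_abs, enorm_mul]

theorem measurable_mul_enorm {F : Ω → ℝ≥0∞} (hF : Measurable F) (g : Ω →ₘ[μ] ℝ) :
    Measurable (fun x => F x * ‖g x‖ₑ) :=
  hF.mul g.measurable.enorm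

theorem koetheNorm_eq_dualNorm (f : Ω →ₘ[μ] ℝ) :
    koetheNorm ρ f = dualNorm ρ (fun x => ‖f x‖ₑ) := by
  simp only [koetheNorm, dualNorm, ofReal_abs_mul_eq_enorm]

theorem lintegral_le_dualNorm (F : Ω → ℝ≥0∞) {g : Ω →ₘ[μ] ℝ} (hg : ρ g ≤ 1) :
    ∫⁻ x, F x * ‖g x‖ₑ ∂μ ≤ dualNorm ρ F :=
  le_iSup₂_of_le g hg le_rfl

theorem dualNorm_mono_ae {F G : Ω → ℝ≥0∞} (h : ∀ᵐ x ∂μ, F x ≤ G x) :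
    dualNorm ρ F ≤ dualNorm ρ G := by
  refine iSup₂_le fun g hg => le_trans (lintegral_mono_ae ?_) (lintegral_le_dualNorm G hg)
  filter_upwards [h] with x hx
  gcongr

theorem dualNorm_mono {F G : Ω → ℝ≥0∞} (h : ∀ x, F x ≤ G x) :
    dualNorm ρ F ≤ dualNorm ρ G :=
  dualNorm_mono_ae (Eventually.of_forall h)

theorem dualNorm_congr_ae {F G : Ω → ℝ≥0∞} (h : ∀ᵐ x ∂μ, F x = G x) :
    dualNorm ρ F = dualNorm ρ G :=
  le_antisymm (dualNorm_mono_ae (h.mono fun _ hx => hx.le))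
    (dualNorm_mono_ae (h.mono fun _ hx => hx.ge))

theorem dualNorm_add_le {F G : Ω → ℝ≥0∞} (hF : Measurable F) :
    dualNorm ρ (fun x => F x + G x) ≤ dualNorm ρ F + dualNorm ρ G := by
  refine iSup₂_le fun g hg => ?_
  simp only [add_mul]
  rw [lintegral_add_left (measurable_mul_enorm hF g)]
  exact add_le_add (lintegral_le_dualNorm F hg) (lintegral_le_dualNorm G hg)

theorem dualNorm_const_mul_le {F : Ω → ℝ≥0∞} (hF : Measurable F) (c : ℝ≥0∞) :
    dualNorm ρ (fun x => c * F x) ≤ c * dualNorm ρ F := by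
  refine iSup₂_le fun g hg => ?_
  simp only [mul_assoc]
  rw [lintegral_const_mul _ (measurable_mul_enorm hF g)]
  gcongr
  exact lintegral_le_dualNorm F hg

theorem dualNorm_tsum_le {ι : Type*} [Countable ι] {F : ι → Ω → ℝ≥0∞}
    (hF : ∀ i, Measurable (F i)) :
    dualNorm ρ (fun x => ∑' i, F i x) ≤ ∑' i, dualNorm ρ (F i) := by
  refine iSup₂_le fun g hg => ?_
  simp only [← ENNReal.tsum_mul_right]
  rw [lintegral_tsum fun i => (measurable_mul_enorm (hF i) g).aemeasurable]
  exact ENNReal.tsum_le_tsum fun i => lintegral_le_dualNorm (F i) hg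

/-- Two functions in the unit ball restricted to complementary sets are, jointly, dominated by `κ`
times one function in the unit ball. -/
def HasDisjointEstimate (ρ : (Ω →ₘ[μ] ℝ) → ℝ≥0∞) (κ : ℝ≥0∞) : Prop :=
  ∀ (A : Set Ω), MeasurableSet A → ∀ u v : Ω →ₘ[μ] ℝ, ρ u ≤ 1 → ρ v ≤ 1 →
    ∃ w : Ω →ₘ[μ] ℝ, ρ w ≤ 1 ∧
      ∀ᵐ x ∂μ, (x ∈ A → ‖u x‖ₑ ≤ κ * ‖w x‖ₑ) ∧ (x ∉ A → ‖v x‖ₑ ≤ κ * ‖w x‖ₑ)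

theorem HasDisjointEstimate.dualNorm_add_le {κ : ℝ≥0∞} (h : HasDisjointEstimate ρ κ)
    {F : Ω → ℝ≥0∞} (hF : Measurable F) {A : Set Ω} (hA : MeasurableSet A) :
    dualNorm ρ (A.indicator F) + dualNorm ρ (Aᶜ.indicator F) ≤ κ * dualNorm ρ F := by
  by_cases hne : ∃ u, ρ u ≤ 1
  swap
  · push Not at hne
    have : ∀ G, dualNorm ρ G = 0 := fun G => by
      simp only [dualNorm, ENNReal.iSup_eq_zero]
      exact fun g hg => absurd hg (hne g).not_ge
    simp [this]
  obtain ⟨u₀, hu₀⟩ := hne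
  have key : ∀ u v : Ω →ₘ[μ] ℝ, ρ u ≤ 1 → ρ v ≤ 1 →
      ∫⁻ x, A.indicator F x * ‖u x‖ₑ ∂μ + ∫⁻ x, Aᶜ.indicator F x * ‖v x‖ₑ ∂μ
        ≤ κ * dualNorm ρ F := by
    intro u v hu hv
    obtain ⟨w, hw, hae⟩ := h A hA u v hu hv
    rw [← lintegral_add_left (measurable_mul_enorm (hF.indicator hA) u)]
    calc _ ≤ ∫⁻ x, κ * (F x * ‖w x‖ₑ) ∂μ := by
          refine lintegral_mono_ae ?_
          filter_upwards [hae] with x hx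
          by_cases hxA : x ∈ A
          · have := hx.1 hxA
            simp only [indicator_of_mem hxA, indicator_of_notMem (notMem_compl_iff.2 hxA),
              zero_mul, add_zero]
            calc F x * ‖u x‖ₑ ≤ F x * (κ * ‖w x‖ₑ) := by gcongr
              _ = _ := by ring
          · have := hx.2 hxA
            simp only [indicator_of_notMem hxA, indicator_of_mem (mem_compl hxA),
              zero_mul, zero_add]
            calc F x * ‖v x‖ₑ ≤ F x * (κ * ‖w x‖ₑ) := by gcongr
              _ = _ := by ring
      _ = κ * ∫⁻ x, F x * ‖w x‖ₑ ∂μ := lintegral_const_mul _ (measurable_mul_enorm hF w)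
      _ ≤ _ := by gcongr; exact lintegral_le_dualNorm F hw
  have : Nonempty {u : Ω →ₘ[μ] ℝ // ρ u ≤ 1} := ⟨⟨u₀, hu₀⟩⟩
  simp only [dualNorm, iSup_subtype'] at key ⊢
  exact ENNReal.iSup_add_iSup_le fun u v => key u v u.2 v.2

theorem dualNorm_iSup_of_monotone {F : ℕ → Ω → ℝ≥0∞} (hF : ∀ n, Measurable (F n))
    (hm : Monotone F) : dualNorm ρ (fun x => ⨆ n, F n x) = ⨆ n, dualNorm ρ (F n) := by
  simp only [dualNorm]
  rw [iSup_comm]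
  refine iSup_congr fun g => ?_
  rw [iSup_comm]
  refine iSup_congr fun hg => ?_
  simp only [ENNReal.iSup_mul]
  rw [lintegral_iSup fun n => measurable_mul_enorm (hF n) g]
  intro i j hij x
  have := hm hij x
  simp only
  gcongr

/-- Order continuity of the dual norm. -/
theorem HasDisjointEstimate.tendsto_dualNorm_indicator {κ : ℝ≥0∞} (h : HasDisjointEstimate ρ κ)
    (hκ : κ < 2) {F : Ω → ℝ≥0∞} (hF : Measurable F) (hfin : dualNorm ρ F ≠ ∞)
    {T : ℕ → Set Ω} (hT : ∀ k, MeasurableSet (T k)) (hanti : Antitone T) (hempty : ⋂ k, T k = ∅) :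
    Tendsto (fun k => dualNorm ρ ((T k).indicator F)) atTop (𝓝 0) := by
  set S : ℕ → ℝ≥0∞ := fun k => dualNorm ρ ((T k).indicator F) with hS
  have hSanti : Antitone S := fun i j hij =>
    dualNorm_mono fun x => indicator_le_indicator_of_subset (hanti hij) (fun _ => zero_le) x
  have hlim : Tendsto S atTop (𝓝 (⨅ k, S k)) := tendsto_atTop_iInf hSanti
  set a := ⨅ k, S k with ha
  have hSfin : ∀ k, S k ≤ dualNorm ρ F := fun k => dualNorm_mono fun x => indicator_le_self _ _ x
  have hafin : a ≠ ∞ := ((iInf_le S 0).trans (hSfin 0)).trans_lt hfin.lt_top |>.ne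
  have step : ∀ k l, dualNorm ρ ((T l)ᶜ.indicator ((T k).indicator F)) + a ≤ κ * S k := by
    intro k l
    rcases le_total k l with hkl | hkl
    · refine le_trans ?_ (h.dualNorm_add_le (hF.indicator (hT k)) (hT l))
      rw [add_comm]
      gcongr
      refine (iInf_le S l).trans (le_of_eq ?_)
      rw [indicator_indicator, inter_eq_left.2 (hanti hkl)]
    · have : (T l)ᶜ.indicator ((T k).indicator F) = fun _ => 0 := by
        rw [indicator_indicator]
        have : (T l)ᶜ ∩ T k = ∅ := by
          rw [← disjoint_iff_inter_eq_empty, disjoint_compl_left_iff_subset]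
          exact hanti hkl
        rw [this]; simp
      rw [this]
      have h0 : dualNorm ρ (fun _ => 0) = 0 := by simp [dualNorm]
      have := h.dualNorm_add_le (hF.indicator (hT k)) (hT k)
      rw [h0, zero_add]
      refine (iInf_le S k).trans (le_trans ?_ this)
      rw [indicator_indicator, inter_self]
      exact le_self_add
  have step2 : ∀ k, S k + a ≤ κ * S k := by
    intro k
    have : S k = ⨆ l, dualNorm ρ ((T l)ᶜ.indicator ((T k).indicator F)) := by
      rw [← dualNorm_iSup_of_monotone]
      · refine congrArg (dualNorm ρ) (funext fun x => ?_)
        obtain ⟨l, hl⟩ : ∃ l, x ∉ T l := by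
          have : x ∉ ⋂ k, T k := by simp [hempty]
          simpa using this
        refine le_antisymm (le_iSup_of_le l ?_) (iSup_le fun l => indicator_le_self _ _ x)
        rw [indicator_of_mem (mem_compl hl)]
      · exact fun l => (hF.indicator (hT k)).indicator (hT l).compl
      · exact fun i j hij x => indicator_le_indicator_of_subset
          (compl_subset_compl.2 (hanti hij)) (fun _ => zero_le) x
    conv_lhs => rw [this]
    rw [ENNReal.iSup_add]
    exact iSup_le fun l => step k l
  have hκtop : κ ≠ ∞ := (hκ.trans ENNReal.ofNat_lt_top).ne
  have step3 : a + a ≤ κ * a :=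
    le_of_tendsto_of_tendsto' (hlim.add_const a)
      (ENNReal.Tendsto.const_mul hlim (Or.inr hκtop)) step2
  have ha0 : a = 0 := by
    by_contra h0
    rw [← two_mul] at step3
    exact absurd step3 (ENNReal.mul_lt_mul_left h0 hafin hκ).not_ge
  rwa [ha0] at hlim

/-- Dominated convergence in the dual norm. -/
theorem HasDisjointEstimate.tendsto_dualNorm_of_dominated {κ : ℝ≥0∞}
    (h : HasDisjointEstimate ρ κ) (hκ : κ < 2) {G : Ω → ℝ≥0∞} (hG : Measurable G)
    (hfin : dualNorm ρ G ≠ ∞) {F : ℕ → Ω → ℝ≥0∞} (hF : ∀ n, Measurable (F n))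
    (hle : ∀ n x, F n x ≤ G x) (hlim : ∀ x, Tendsto (fun n => F n x) atTop (𝓝 0)) :
    Tendsto (fun n => dualNorm ρ (F n)) atTop (𝓝 0) := by
  have main : ∀ ε : ℝ≥0∞, ε ≠ 0 → ε ≠ ∞ →
      ∀ᶠ n in atTop, dualNorm ρ (F n) ≤ ε + ε * dualNorm ρ G := by
    intro ε hε hεt
    set T : ℕ → Set Ω := fun k => ⋃ n ∈ Ici k, {x | ε * G x < F n x} with hTdef
    have hT : ∀ k, MeasurableSet (T k) := fun k =>
      MeasurableSet.biUnion (to_countable _) fun n _ =>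
        measurableSet_lt (hG.const_mul ε) (hF n)
    have hanti : Antitone T := fun i j hij =>
      biUnion_subset_biUnion_left (Ici_subset_Ici.2 hij)
    have hempty : ⋂ k, T k = ∅ := by
      refine eq_empty_of_forall_notMem fun x hx => ?_
      rw [mem_iInter] at hx
      by_cases h0 : G x = 0
      · obtain ⟨n, -, hn⟩ := mem_iUnion₂.1 (hx 0)
        exact absurd ((hle n x).trans h0.le) (lt_of_le_of_lt (zero_le) hn).not_ge
      · have hpos : 0 < ε * G x := pos_iff_ne_zero.2 (mul_ne_zero hε h0)
        obtain ⟨N, hN⟩ := eventually_atTop.1 ((hlim x).eventually_lt_const hpos)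
        obtain ⟨n, hn, hlt⟩ := mem_iUnion₂.1 (hx N)
        exact lt_asymm hlt (hN n hn)
    filter_upwards [(h.tendsto_dualNorm_indicator hκ hG hfin hT hanti hempty).eventually_le_const
      (pos_iff_ne_zero.2 hε)] with n hn
    calc dualNorm ρ (F n) ≤ dualNorm ρ (fun x => (T n).indicator G x + ε * G x) := by
          refine dualNorm_mono fun x => ?_
          by_cases hx : ε * G x < F n x
          · have : x ∈ T n := mem_iUnion₂.2 ⟨n, mem_Ici.2 le_rfl, hx⟩
            rw [indicator_of_mem this]
            exact (hle n x).trans le_self_add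
          · exact (not_lt.1 hx).trans le_add_self
      _ ≤ dualNorm ρ ((T n).indicator G) + dualNorm ρ (fun x => ε * G x) :=
          _root_.dualNorm_add_le (hG.indicator (hT n))
      _ ≤ ε + ε * dualNorm ρ G := add_le_add hn (dualNorm_const_mul_le hG ε)
  rw [ENNReal.tendsto_nhds_zero]
  intro δ hδ
  rcases eq_or_ne δ ∞ with rfl | hδt
  · simp
  set D := 1 + dualNorm ρ G with hD
  have hDt : D ≠ ∞ := ENNReal.add_ne_top.2 ⟨ENNReal.one_ne_top, hfin⟩
  have hD0 : D ≠ 0 := by simp [hD]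
  filter_upwards [main (δ / D) (ENNReal.div_pos hδ.ne' hDt).ne' (ENNReal.div_ne_top hδt hD0)]
    with n hn
  refine hn.trans (le_of_eq ?_)
  rw [← mul_one_add, ENNReal.div_mul_cancel hD0 hDt]

end DualNorm

section Representation

variable {Ω : Type*} [MeasurableSpace Ω] {μ : Measure Ω} {ρ : (Ω →ₘ[μ] ℝ) → ℝ≥0∞}

theorem KoetheDual.ext_ae {f g : KoetheDual ρ} (h : ∀ᵐ x ∂μ, f.toAEEqFun x = g.toAEEqFun x) :
    f = g :=
  Subtype.ext (AEEqFun.ext h)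

theorem koetheNorm_mk {f : Ω → ℝ} (hf : AEStronglyMeasurable f μ) :
    koetheNorm ρ (AEEqFun.mk f hf) = dualNorm ρ (fun x => ‖f x‖ₑ) := by
  rw [koetheNorm_eq_dualNorm]
  refine dualNorm_congr_ae ?_
  filter_upwards [AEEqFun.coeFn_mk f hf] with x hx
  rw [hx]

/-- A measurable function with finite dual norm, as an element of the Köthe dual. -/
noncomputable def KoetheDual.ofFun (f : Ω → ℝ) (hf : Measurable f)
    (h : dualNorm ρ (fun x => ‖f x‖ₑ) ≠ ∞) : KoetheDual ρ :=
  ⟨AEEqFun.mk f hf.aestronglyMeasurable, by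
    change koetheNorm ρ _ < ∞
    rw [koetheNorm_mk]; exact h.lt_top⟩

theorem KoetheDual.coeFn_ofFun {f : Ω → ℝ} (hf : Measurable f)
    (h : dualNorm ρ (fun x => ‖f x‖ₑ) ≠ ∞) :
    ∀ᵐ x ∂μ, (KoetheDual.ofFun f hf h).toAEEqFun x = f x :=
  AEEqFun.coeFn_mk f _

theorem KoetheDual.norm_ofFun {f : Ω → ℝ} (hf : Measurable f)
    (h : dualNorm ρ (fun x => ‖f x‖ₑ) ≠ ∞) :
    ‖KoetheDual.ofFun f hf h‖ = (dualNorm ρ (fun x => ‖f x‖ₑ)).toReal := by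
  rw [KoetheDual.norm_def]
  exact congrArg ENNReal.toReal (koetheNorm_mk _)

theorem KoetheDual.dualNorm_ne_top (f : KoetheDual ρ) :
    dualNorm ρ (fun x => ‖f.toAEEqFun x‖ₑ) ≠ ∞ := by
  rw [← koetheNorm_eq_dualNorm]
  exact (show koetheNorm ρ f.toAEEqFun < ∞ from f.2).ne

theorem KoetheDual.coeFn_add (f g : KoetheDual ρ) :
    ∀ᵐ x ∂μ, (f + g).toAEEqFun x = f.toAEEqFun x + g.toAEEqFun x :=
  AEEqFun.coeFn_add f.toAEEqFun g.toAEEqFun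

theorem KoetheDual.coeFn_sub (f g : KoetheDual ρ) :
    ∀ᵐ x ∂μ, (f - g).toAEEqFun x = f.toAEEqFun x - g.toAEEqFun x :=
  AEEqFun.coeFn_sub f.toAEEqFun g.toAEEqFun

theorem KoetheDual.coeFn_smul (c : ℝ) (f : KoetheDual ρ) :
    ∀ᵐ x ∂μ, (c • f).toAEEqFun x = c * f.toAEEqFun x :=
  AEEqFun.coeFn_smul c f.toAEEqFun

theorem dualNorm_simpleFunc_mul_ne_top {φ : Ω → ℝ} (hφ : Measurable φ)
    (hfin : dualNorm ρ (fun x => ‖φ x‖ₑ) ≠ ∞) (s : SimpleFunc Ω ℝ) :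
    dualNorm ρ (fun x => ‖s x * φ x‖ₑ) ≠ ∞ := by
  obtain ⟨C, hC⟩ := s.exists_forall_norm_le
  refine ne_top_of_le_ne_top (ENNReal.mul_ne_top (ENNReal.ofReal_ne_top (r := C)) hfin)
    (le_trans (dualNorm_mono fun x => ?_) (dualNorm_const_mul_le hφ.enorm _))
  rw [enorm_mul, ← ofReal_norm (s x)]
  gcongr
  exact hC x

/-- Multiplication of simple functions by a fixed element of the Köthe dual. -/
noncomputable def simpleFuncMul {φ : Ω → ℝ} (hφ : Measurable φ)
    (hfin : dualNorm ρ (fun x => ‖φ x‖ₑ) ≠ ∞) : SimpleFunc Ω ℝ →ₗ[ℝ] KoetheDual ρ where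
  toFun s := KoetheDual.ofFun (fun x => s x * φ x) (s.measurable.mul hφ)
    (dualNorm_simpleFunc_mul_ne_top hφ hfin s)
  map_add' s t := by
    refine KoetheDual.ext_ae ?_
    filter_upwards [KoetheDual.coeFn_ofFun _ (dualNorm_simpleFunc_mul_ne_top hφ hfin (s + t)),
      KoetheDual.coeFn_ofFun _ (dualNorm_simpleFunc_mul_ne_top hφ hfin s),
      KoetheDual.coeFn_ofFun _ (dualNorm_simpleFunc_mul_ne_top hφ hfin t),
      KoetheDual.coeFn_add (KoetheDual.ofFun _ _ (dualNorm_simpleFunc_mul_ne_top hφ hfin s))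
        (KoetheDual.ofFun _ _ (dualNorm_simpleFunc_mul_ne_top hφ hfin t))] with x h1 h2 h3 h4
    rw [h1, h4, h2, h3, SimpleFunc.coe_add, Pi.add_apply, add_mul]
  map_smul' c s := by
    refine KoetheDual.ext_ae ?_
    filter_upwards [KoetheDual.coeFn_ofFun _ (dualNorm_simpleFunc_mul_ne_top hφ hfin (c • s)),
      KoetheDual.coeFn_ofFun _ (dualNorm_simpleFunc_mul_ne_top hφ hfin s),
      KoetheDual.coeFn_smul c
        (KoetheDual.ofFun _ _ (dualNorm_simpleFunc_mul_ne_top hφ hfin s))] with x h1 h2 h3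
    rw [h1, RingHom.id_apply, h3, h2, SimpleFunc.coe_smul, Pi.smul_apply, smul_eq_mul, mul_assoc]

theorem coeFn_simpleFuncMul {φ : Ω → ℝ} (hφ : Measurable φ)
    (hfin : dualNorm ρ (fun x => ‖φ x‖ₑ) ≠ ∞) (s : SimpleFunc Ω ℝ) :
    ∀ᵐ x ∂μ, (simpleFuncMul hφ hfin s).toAEEqFun x = s x * φ x :=
  KoetheDual.coeFn_ofFun (s.measurable.mul hφ) (dualNorm_simpleFunc_mul_ne_top hφ hfin s)

theorem norm_simpleFuncMul {φ : Ω → ℝ} (hφ : Measurable φ)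
    (hfin : dualNorm ρ (fun x => ‖φ x‖ₑ) ≠ ∞) (s : SimpleFunc Ω ℝ) :
    ‖simpleFuncMul hφ hfin s‖ = (dualNorm ρ (fun x => ‖s x * φ x‖ₑ)).toReal :=
  KoetheDual.norm_ofFun (s.measurable.mul hφ) (dualNorm_simpleFunc_mul_ne_top hφ hfin s)

/-- The indicator of a measurable set as a simple function. -/
noncomputable def simpleIndicator {A : Set Ω} (hA : MeasurableSet A) : SimpleFunc Ω ℝ :=
  SimpleFunc.piecewise A hA (SimpleFunc.const Ω 1) (SimpleFunc.const Ω 0)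

theorem simpleIndicator_apply {A : Set Ω} (hA : MeasurableSet A) (x : Ω) :
    simpleIndicator hA x = A.indicator (fun _ => (1 : ℝ)) x := by
  classical
  simp [simpleIndicator, SimpleFunc.piecewise_apply, indicator_apply]

theorem SimpleFunc.sum_apply {ι : Type*} (s : Finset ι) (f : ι → SimpleFunc Ω ℝ) (x : Ω) :
    (∑ i ∈ s, f i) x = ∑ i ∈ s, f i x := by
  classical
  induction s using Finset.induction_on with
  | empty => simp
  | insert a s ha ih => rw [Finset.sum_insert ha, Finset.sum_insert ha, ← ih]; rfl

theorem abs_indicator_iUnion_sub_sum_le {X : Type*} {f : ℕ → Set X}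
    (hd : Pairwise (Function.onFun Disjoint f))
    {s : Finset ℕ} {k : ℕ} (hs : Finset.range k ⊆ s) (x : X) :
    |(⋃ i, f i).indicator (fun _ => (1 : ℝ)) x - ∑ i ∈ s, (f i).indicator (fun _ => (1 : ℝ)) x| ≤
      (⋃ i ∈ Ici k, f i).indicator (fun _ => (1 : ℝ)) x := by
  by_cases hx : x ∈ ⋃ i, f i
  · obtain ⟨j, hj⟩ := mem_iUnion.1 hx
    have hne : ∀ i, i ≠ j → (f i).indicator (fun _ => (1 : ℝ)) x = 0 := fun i hi =>
      indicator_of_notMem (fun h => disjoint_left.1 (hd hi) h hj) _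
    by_cases hjs : j ∈ s
    · rw [Finset.sum_eq_single_of_mem j hjs fun i _ hi => hne i hi, indicator_of_mem hx,
        indicator_of_mem hj, sub_self, abs_zero]
      exact indicator_nonneg (fun _ _ => zero_le_one) x
    · have hjk : k ≤ j := by
        by_contra hlt
        exact hjs (hs (Finset.mem_range.2 (not_le.1 hlt)))
      rw [Finset.sum_eq_zero fun i hi => hne i fun h => hjs (h ▸ hi), indicator_of_mem hx,
        indicator_of_mem (mem_biUnion (mem_Ici.2 hjk) hj)]
      simp
  · have hx' : ∀ i, x ∉ f i := fun i hi => hx (mem_iUnion.2 ⟨i, hi⟩)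
    rw [indicator_of_notMem hx, Finset.sum_eq_zero fun i _ => indicator_of_notMem (hx' i) _]
    simpa using indicator_nonneg (fun _ _ => zero_le_one) x

theorem HasDisjointEstimate.hasSum_indicator {κ : ℝ≥0∞} (h : HasDisjointEstimate ρ κ) (hκ : κ < 2)
    {φ : Ω → ℝ} (hφ : Measurable φ) (hfin : dualNorm ρ (fun x => ‖φ x‖ₑ) ≠ ∞)
    (L : StrongDual ℝ (KoetheDual ρ)) {f : ℕ → Set Ω} (hf : ∀ i, MeasurableSet (f i))
    (hd : Pairwise (Function.onFun Disjoint f)) :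
    HasSum (fun i => L (simpleFuncMul hφ hfin (simpleIndicator (hf i))))
      (L (simpleFuncMul hφ hfin (simpleIndicator (MeasurableSet.iUnion hf)))) := by
  set T : ℕ → Set Ω := fun k => ⋃ i ∈ Ici k, f i with hTdef
  have hT : ∀ k, MeasurableSet (T k) := fun k =>
    MeasurableSet.biUnion (to_countable _) fun n _ => hf n
  have hanti : Antitone T := fun i j hij => biUnion_subset_biUnion_left (Ici_subset_Ici.2 hij)
  have hempty : ⋂ k, T k = ∅ := by
    refine eq_empty_of_forall_notMem fun x hx => ?_
    rw [mem_iInter] at hx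
    obtain ⟨j, -, hj⟩ := mem_iUnion₂.1 (hx 0)
    obtain ⟨i, hi, hi'⟩ := mem_iUnion₂.1 (hx (j + 1))
    exact disjoint_left.1 (hd (show i ≠ j by have := mem_Ici.1 hi; omega)) hi' hj
  have htend := h.tendsto_dualNorm_indicator hκ hφ.enorm hfin hT hanti hempty
  have htend' := ((ENNReal.tendsto_toReal ENNReal.zero_ne_top).comp htend).const_mul ‖L‖
  rw [ENNReal.toReal_zero, mul_zero] at htend'
  unfold HasSum
  rw [SummationFilter.unconditional_filter, Metric.tendsto_atTop]
  intro ε hε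
  obtain ⟨k, hk⟩ := (htend'.eventually_lt_const hε).exists
  refine ⟨Finset.range k, fun s hs => lt_of_le_of_lt ?_ hk⟩
  rw [dist_comm, Real.dist_eq, ← map_sum, ← map_sum, ← map_sub, ← map_sub, ← Real.norm_eq_abs]
  refine (L.le_opNorm _).trans ?_
  rw [norm_simpleFuncMul]
  refine mul_le_mul_of_nonneg_left (ENNReal.toReal_mono ?_ (dualNorm_mono fun x => ?_))
    (norm_nonneg _)
  · exact ne_top_of_le_ne_top hfin (dualNorm_mono fun x => indicator_le_self _ _ x)
  · have hb := abs_indicator_iUnion_sub_sum_le hd hs x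
    rw [SimpleFunc.coe_sub, Pi.sub_apply, SimpleFunc.sum_apply, enorm_mul]
    simp only [simpleIndicator_apply]
    by_cases hx : x ∈ T k
    · rw [indicator_of_mem hx] at hb ⊢
      rw [Real.enorm_eq_ofReal_abs]
      calc _ ≤ ENNReal.ofReal 1 * ‖φ x‖ₑ := by gcongr
        _ = _ := by simp
    · rw [indicator_of_notMem hx] at hb ⊢
      rw [abs_nonpos_iff.1 hb]
      simp

/-- A continuous linear functional on the Köthe dual is given on simple multiples of `φ` by an
integrable density. -/
theorem HasDisjointEstimate.exists_density [SigmaFinite μ] {κ : ℝ≥0∞}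
    (h : HasDisjointEstimate ρ κ) (hκ : κ < 2) {φ : Ω → ℝ} (hφ : Measurable φ)
    (hfin : dualNorm ρ (fun x => ‖φ x‖ₑ) ≠ ∞) (L : StrongDual ℝ (KoetheDual ρ)) :
    ∃ γ : Ω → ℝ, Measurable γ ∧ Integrable γ μ ∧
      ∀ s : SimpleFunc Ω ℝ, L (simpleFuncMul hφ hfin s) = ∫ x, s x * γ x ∂μ := by
  classical
  have hzero : ∀ s : SimpleFunc Ω ℝ, (∀ᵐ x ∂μ, s x = 0) → simpleFuncMul hφ hfin s = 0 := by
    intro s hs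
    rw [← map_zero (simpleFuncMul hφ hfin)]
    refine KoetheDual.ext_ae ?_
    filter_upwards [coeFn_simpleFuncMul hφ hfin s, coeFn_simpleFuncMul hφ hfin 0, hs]
      with x h1 h2 h3
    rw [h1, h2, h3]; rfl
  let ν : SignedMeasure Ω :=
    { measureOf' := fun A =>
        if hA : MeasurableSet A then L (simpleFuncMul hφ hfin (simpleIndicator hA)) else 0
      empty' := by
        rw [dif_pos MeasurableSet.empty, hzero _ (Eventually.of_forall fun x => ?_), map_zero]
        simp [simpleIndicator_apply]
      not_measurable' := fun A hA => dif_neg hA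
      m_iUnion' := fun f hf hd => by
        have := h.hasSum_indicator hκ hφ hfin L hf hd
        simpa only [dif_pos (hf _), dif_pos (MeasurableSet.iUnion hf)] using this }
  have hν : ∀ A (hA : MeasurableSet A), ν A = L (simpleFuncMul hφ hfin (simpleIndicator hA)) :=
    fun A hA => dif_pos hA
  have hac : ν ≪ᵥ μ.toENNRealVectorMeasure := by
    refine VectorMeasure.AbsolutelyContinuous.mk fun A hA h0 => ?_
    rw [Measure.toENNRealVectorMeasure_apply_measurable hA] at h0
    rw [hν A hA, hzero, map_zero]
    filter_upwards [measure_eq_zero_iff_ae_notMem.1 h0] with x hx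
    rw [simpleIndicator_apply, indicator_of_notMem hx]
  have hRN := (SignedMeasure.absolutelyContinuous_iff_withDensityᵥ_rnDeriv_eq ν μ).1 hac
  have hint : Integrable (ν.rnDeriv μ) μ := SignedMeasure.integrable_rnDeriv ν μ
  have hintmul : ∀ s : SimpleFunc Ω ℝ, Integrable (fun x => s x * ν.rnDeriv μ x) μ := fun s => by
    obtain ⟨C, hC⟩ := s.exists_forall_norm_le
    exact hint.bdd_mul s.measurable.aestronglyMeasurable (Eventually.of_forall hC)
  refine ⟨ν.rnDeriv μ, SignedMeasure.measurable_rnDeriv ν μ, hint, fun s => ?_⟩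
  induction s using SimpleFunc.induction with
  | const c hA =>
    rename_i A
    have hs : SimpleFunc.piecewise A hA (SimpleFunc.const Ω c) (SimpleFunc.const Ω 0) =
        c • simpleIndicator hA := by
      ext x
      simp only [simpleIndicator, SimpleFunc.piecewise_apply, SimpleFunc.coe_smul, Pi.smul_apply]
      split_ifs <;> simp
    rw [hs, map_smul, map_smul, ← hν A hA]
    conv_lhs => rw [← hRN]
    rw [withDensityᵥ_apply hint hA, ← integral_indicator hA, smul_eq_mul, ← integral_const_mul]
    congr 1
    ext x
    rw [SimpleFunc.coe_smul, Pi.smul_apply, simpleIndicator_apply]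
    by_cases hx : x ∈ A <;> simp [hx]
  | add _ hs ht =>
    rename_i s t _
    rw [map_add, map_add, hs, ht, ← integral_add (hintmul s) (hintmul t)]
    congr 1
    ext x
    rw [SimpleFunc.coe_add, Pi.add_apply, add_mul]

/-- If the predual ball satisfies a disjoint estimate with constant less than `2`, every continuous
linear functional on the Köthe dual is integration against a function. -/
theorem HasDisjointEstimate.exists_represents [SigmaFinite μ] {κ : ℝ≥0∞}
    (h : HasDisjointEstimate ρ κ) (hκ : κ < 2) {φ : Ω → ℝ} (hφ : Measurable φ)
    (hpos : ∀ x, 0 < φ x) (hfin : dualNorm ρ (fun x => ‖φ x‖ₑ) ≠ ∞)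
    (L : StrongDual ℝ (KoetheDual ρ)) : ∃ g : Ω →ₘ[μ] ℝ, Represents L g := by
  obtain ⟨γ, hγm, hγi, hγ⟩ := h.exists_density hκ hφ hfin L
  have hgm : Measurable (fun x => γ x / φ x) := hγm.div hφ
  refine ⟨AEEqFun.mk _ hgm.aestronglyMeasurable, fun f => ?_⟩
  have hcoe := AEEqFun.coeFn_mk (μ := μ) _ hgm.aestronglyMeasurable
  set ψ : Ω → ℝ := fun x => f.toAEEqFun x / φ x with hψ
  have hψm : Measurable ψ := f.toAEEqFun.measurable.div hφ
  have hψφ : ∀ x, ψ x * φ x = f.toAEEqFun x := fun x => div_mul_cancel₀ _ (hpos x).ne'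
  have hae : ∀ᵐ x ∂μ, f.toAEEqFun x * (AEEqFun.mk _ hgm.aestronglyMeasurable : Ω →ₘ[μ] ℝ) x =
      ψ x * γ x := by
    filter_upwards [hcoe] with x hx
    rw [hx, hψ]; ring
  set s : ℕ → SimpleFunc Ω ℝ := SimpleFunc.approxOn ψ hψm univ 0 (mem_univ _) with hs
  have hslim : ∀ x, Tendsto (fun n => s n x) atTop (𝓝 (ψ x)) := fun x =>
    SimpleFunc.tendsto_approxOn hψm _ (by simp)
  have hsle : ∀ n x, ‖s n x‖ ≤ 2 * ‖ψ x‖ := fun n x => by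
    rw [two_mul]; exact SimpleFunc.norm_approxOn_zero_le hψm _ x n
  have hsle' : ∀ n x, ‖s n x * φ x‖ₑ ≤ 2 * ‖f.toAEEqFun x‖ₑ := fun n x => by
    rw [← hψφ x, enorm_mul, enorm_mul, ← mul_assoc]
    gcongr
    rw [← ofReal_norm (s n x), ← ofReal_norm (ψ x)]
    refine (ENNReal.ofReal_le_ofReal (hsle n x)).trans ?_
    rw [ENNReal.ofReal_mul zero_le_two, ENNReal.ofReal_ofNat]
  set B : ℝ≥0∞ := 2 * dualNorm ρ (fun x => ‖f.toAEEqFun x‖ₑ) with hB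
  have hBfin : B ≠ ∞ := ENNReal.mul_ne_top ENNReal.ofNat_ne_top f.dualNorm_ne_top
  have hfm : Measurable (fun x => ‖f.toAEEqFun x‖ₑ) := f.toAEEqFun.measurable.enorm
  have hint : Integrable (fun x => ψ x * γ x) μ := by
    let σ : SimpleFunc Ω ℝ := SimpleFunc.piecewise {x | 0 ≤ γ x}
      (measurableSet_le measurable_const hγm) (SimpleFunc.const Ω 1) (SimpleFunc.const Ω (-1))
    have hσ : ∀ x, σ x * γ x = |γ x| ∧ ‖σ x‖ₑ = 1 := by
      classical
      intro x
      simp only [σ, SimpleFunc.piecewise_apply, SimpleFunc.coe_const, Function.const_apply]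
      split_ifs with hx
      · exact ⟨by rw [one_mul, abs_of_nonneg hx], by simp⟩
      · exact ⟨by rw [abs_of_neg (not_le.1 hx)]; ring, by simp⟩
    refine ⟨(hψm.mul hγm).aestronglyMeasurable, ?_⟩
    have hbound : ∀ n, ∫⁻ x, ‖s n x * γ x‖ₑ ∂μ ≤ ENNReal.ofReal (‖L‖ * B.toReal) := by
      intro n
      have hi : Integrable (fun x => s n x * γ x) μ := by
        obtain ⟨C, hC⟩ := (s n).exists_forall_norm_le
        exact hγi.bdd_mul (s n).measurable.aestronglyMeasurable (Eventually.of_forall hC)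
      rw [← ofReal_integral_norm_eq_lintegral_enorm hi]
      refine ENNReal.ofReal_le_ofReal ?_
      let t : SimpleFunc Ω ℝ := (s n).map (fun r => |r|) * σ
      have ht : ∀ x, t x = |s n x| * σ x := fun x => rfl
      have := hγ t
      have e : (fun x => ‖s n x * γ x‖) = fun x => t x * γ x := by
        ext x
        rw [ht, mul_assoc, (hσ x).1, Real.norm_eq_abs, abs_mul]
      rw [e, ← this]
      refine (le_abs_self _).trans ((L.le_opNorm _).trans ?_)
      refine mul_le_mul_of_nonneg_left ?_ (norm_nonneg _)
      rw [norm_simpleFuncMul]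
      refine ENNReal.toReal_mono hBfin (le_trans (dualNorm_mono fun x => ?_)
        (dualNorm_const_mul_le hfm 2))
      refine le_trans (le_of_eq ?_) (hsle' n x)
      rw [ht, enorm_mul, enorm_mul, (hσ x).2, mul_one, enorm_mul, Real.enorm_abs]
    calc ∫⁻ x, ‖ψ x * γ x‖ₑ ∂μ = ∫⁻ x, liminf (fun n => ‖s n x * γ x‖ₑ) atTop ∂μ := by
          refine lintegral_congr fun x => ?_
          exact (((hslim x).mul_const (γ x)).enorm).liminf_eq.symm
      _ ≤ liminf (fun n => ∫⁻ x, ‖s n x * γ x‖ₑ ∂μ) atTop :=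
          lintegral_liminf_le fun n => ((s n).measurable.mul hγm).enorm
      _ ≤ ENNReal.ofReal (‖L‖ * B.toReal) :=
          (liminf_le_liminf (Eventually.of_forall hbound)).trans (by simp)
      _ < ∞ := ENNReal.ofReal_lt_top
  refine ⟨hint.congr (hae.mono fun x hx => hx.symm), ?_⟩
  rw [integral_congr_ae hae]
  have lim1 : Tendsto (fun n => ∫ x, s n x * γ x ∂μ) atTop (𝓝 (∫ x, ψ x * γ x ∂μ)) := by
    refine tendsto_integral_of_dominated_convergence (fun x => 2 * ‖ψ x * γ x‖)
      (fun n => ((s n).measurable.mul hγm).aestronglyMeasurable) (hint.norm.const_mul 2)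
      (fun n => Eventually.of_forall fun x => ?_)
      (Eventually.of_forall fun x => (hslim x).mul_const _)
    rw [norm_mul, norm_mul, ← mul_assoc]
    exact mul_le_mul_of_nonneg_right (hsle n x) (norm_nonneg _)
  have lim2 : Tendsto (fun n => simpleFuncMul hφ hfin (s n)) atTop (𝓝 f) := by
    rw [tendsto_iff_norm_sub_tendsto_zero]
    have hd : ∀ n, ‖simpleFuncMul hφ hfin (s n) - f‖ =
        (dualNorm ρ (fun x => ‖s n x * φ x - f.toAEEqFun x‖ₑ)).toReal := by
      intro n
      rw [KoetheDual.norm_def, koetheNorm_eq_dualNorm]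
      refine congrArg ENNReal.toReal (dualNorm_congr_ae ?_)
      filter_upwards [KoetheDual.coeFn_sub (simpleFuncMul hφ hfin (s n)) f,
        coeFn_simpleFuncMul hφ hfin (s n)] with x h1 h2
      rw [h1, h2]
    simp only [hd]
    rw [← ENNReal.toReal_zero]
    refine (ENNReal.tendsto_toReal ENNReal.zero_ne_top).comp ?_
    refine h.tendsto_dualNorm_of_dominated hκ (G := fun x => 3 * ‖f.toAEEqFun x‖ₑ)
      (hfm.const_mul 3) ?_ (fun n => ?_) (fun n x => ?_) (fun x => ?_)
    · exact ne_top_of_le_ne_top (ENNReal.mul_ne_top ENNReal.ofNat_ne_top f.dualNorm_ne_top)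
        (dualNorm_const_mul_le hfm 3)
    · exact (((s n).measurable.mul hφ).sub f.toAEEqFun.measurable).enorm
    · refine (enorm_sub_le).trans ((add_le_add_left (hsle' n x) _).trans (le_of_eq ?_))
      ring
    · have := (((hslim x).mul_const (φ x)).sub_const (f.toAEEqFun x)).enorm
      simpa [hψφ x] using this
  have lim3 := (L.continuous.tendsto f).comp lim2
  refine tendsto_nhds_unique lim3 ?_
  simpa only [Function.comp_def, hγ] using lim1

end Representation

theorem ENNReal.le_mul_of_forall_ofReal_gt {a b I : ℝ≥0∞} (hb : b ≠ ∞)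
    (h : ∀ t : ℝ, 0 < t → a < ENNReal.ofReal t → I ≤ ENNReal.ofReal t * b) (ha : a ≠ ∞) :
    I ≤ a * b := by
  refine le_of_forall_gt_imp_ge_of_dense fun d hd => ?_
  by_cases hd' : d = ∞
  · simp [hd']
  by_cases hb0 : b = 0
  · subst hb0
    obtain ⟨r, hr, hr'⟩ := ENNReal.lt_iff_exists_real_btwn.1 ha.lt_top
    have := h r (ENNReal.ofReal_pos.1 (pos_of_gt hr'.1)) hr'.1
    exact this.trans (by simp)
  · have hlt : a < d / b := by rwa [ENNReal.lt_div_iff_mul_lt (Or.inl hb0) (Or.inl hb)]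
    obtain ⟨r, hr, hr'⟩ := ENNReal.lt_iff_exists_real_btwn.1 hlt
    refine (h r (ENNReal.ofReal_pos.1 (pos_of_gt hr'.1)) hr'.1).trans ?_
    exact ENNReal.mul_le_of_le_div hr'.2.le

section KoetheDualIso

variable {Ω : Type*} [MeasurableSpace Ω] {μ : Measure Ω} {ρ : (Ω →ₘ[μ] ℝ) → ℝ≥0∞}

/-- An everywhere positive element of the Köthe dual, from a countable cover by sets whose indicator
functions have finite dual norm. -/
theorem exists_pos_dualNorm_ne_top {D : ℕ → Set Ω} (hD : ∀ k, MeasurableSet (D k))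
    (hcover : ⋃ k, D k = univ) (hfin : ∀ k, dualNorm ρ ((D k).indicator fun _ => 1) ≠ ∞) :
    ∃ φ : Ω → ℝ, Measurable φ ∧ (∀ x, 0 < φ x) ∧ dualNorm ρ (fun x => ‖φ x‖ₑ) ≠ ∞ := by
  obtain ⟨δ, hδ, hsum⟩ := ENNReal.exists_pos_tsum_mul_lt_of_countable one_ne_zero
    (fun k => dualNorm ρ ((D k).indicator fun _ => 1) + 1)
    (fun k => ENNReal.add_ne_top.2 ⟨hfin k, ENNReal.one_ne_top⟩)
  let Φ : Ω → ℝ≥0∞ := fun x => ∑' k, (δ k : ℝ≥0∞) * (D k).indicator (fun _ => 1) x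
  have hm : ∀ k, Measurable ((D k).indicator fun _ => (1 : ℝ≥0∞)) := fun k =>
    measurable_const.indicator (hD k)
  have hΦ : Measurable Φ := Measurable.tsum fun k => (hm k).const_mul _
  have hΦle : ∀ x, Φ x ≤ 1 := by
    refine fun x => le_trans (ENNReal.tsum_le_tsum fun k => ?_) hsum.le
    rw [mul_comm]
    gcongr
    exact (indicator_le_self' (fun _ _ => zero_le) x).trans le_add_self
  have hΦt : ∀ x, Φ x ≠ ∞ := fun x => ((hΦle x).trans_lt ENNReal.one_lt_top).ne
  have hΦpos : ∀ x, Φ x ≠ 0 := by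
    intro x h0
    obtain ⟨k, hk⟩ := mem_iUnion.1 (hcover ▸ mem_univ x : x ∈ ⋃ k, D k)
    have := ENNReal.tsum_eq_zero.1 h0 k
    rw [indicator_of_mem hk, mul_one] at this
    exact (hδ k).ne' (by exact_mod_cast this)
  refine ⟨fun x => (Φ x).toReal, hΦ.ennreal_toReal,
    fun x => ENNReal.toReal_pos (hΦpos x) (hΦt x), ?_⟩
  refine ne_top_of_le_ne_top ENNReal.one_ne_top (le_trans ?_ hsum.le)
  have : (fun x => ‖(Φ x).toReal‖ₑ) = Φ := funext fun x => by
    rw [Real.enorm_of_nonneg ENNReal.toReal_nonneg, ENNReal.ofReal_toReal (hΦt x)]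
  rw [this]
  refine (dualNorm_tsum_le fun k => (hm k).const_mul _).trans (ENNReal.tsum_le_tsum fun k => ?_)
  refine (dualNorm_const_mul_le (hm k) _).trans ?_
  rw [mul_comm]
  gcongr
  exact le_self_add

/-- Hölder's inequality for the Köthe dual. -/
theorem lintegral_mul_le_koetheNorm_mul
    (hsmul : ∀ t : ℝ, 0 < t → ∀ g, ρ (t • g) ≤ ENNReal.ofReal t * ρ g)
    {f g : Ω →ₘ[μ] ℝ} (hf : koetheNorm ρ f ≠ ∞) (hg : ρ g ≠ ∞) :
    ∫⁻ x, ‖f x * g x‖ₑ ∂μ ≤ ρ g * koetheNorm ρ f := by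
  refine ENNReal.le_mul_of_forall_ofReal_gt hf (fun t ht hlt => ?_) hg
  have h1 : ρ (t⁻¹ • g) ≤ 1 := by
    refine (hsmul _ (inv_pos.2 ht) g).trans ?_
    rw [ENNReal.ofReal_inv_of_pos ht, mul_comm, ← div_eq_mul_inv]
    exact ENNReal.div_le_of_le_mul (by rw [one_mul]; exact hlt.le)
  have h2 : ∫⁻ x, ‖f x‖ₑ * ‖(t⁻¹ • g : Ω →ₘ[μ] ℝ) x‖ₑ ∂μ ≤ koetheNorm ρ f := by
    rw [koetheNorm_eq_dualNorm]
    exact lintegral_le_dualNorm _ h1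
  calc ∫⁻ x, ‖f x * g x‖ₑ ∂μ
      = ∫⁻ x, ENNReal.ofReal t * (‖f x‖ₑ * ‖(t⁻¹ • g : Ω →ₘ[μ] ℝ) x‖ₑ) ∂μ := by
        refine lintegral_congr_ae ?_
        filter_upwards [AEEqFun.coeFn_smul t⁻¹ g] with x hx
        rw [hx, Pi.smul_apply, smul_eq_mul, ← Real.enorm_of_nonneg ht.le, ← enorm_mul, ← enorm_mul]
        congr 1
        field_simp
    _ = ENNReal.ofReal t * ∫⁻ x, ‖f x‖ₑ * ‖(t⁻¹ • g : Ω →ₘ[μ] ℝ) x‖ₑ ∂μ :=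
        lintegral_const_mul' _ _ ENNReal.ofReal_ne_top
    _ ≤ _ := by gcongr

/-- The functional on the Köthe dual given by integration against `g`. -/
theorem exists_functional_of_ne_top
    (hsmul : ∀ t : ℝ, 0 < t → ∀ g, ρ (t • g) ≤ ENNReal.ofReal t * ρ g)
    {g : Ω →ₘ[μ] ℝ} (hg : ρ g ≠ ∞) :
    ∃ L : StrongDual ℝ (KoetheDual ρ), Represents L g ∧ ‖L‖ ≤ (ρ g).toReal := by
  have hfin : ∀ f : KoetheDual ρ, koetheNorm ρ f.toAEEqFun ≠ ∞ := fun f =>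
    (show koetheNorm ρ f.toAEEqFun < ∞ from f.2).ne
  have hle : ∀ f : KoetheDual ρ, ∫⁻ x, ‖f.toAEEqFun x * g x‖ₑ ∂μ ≤
      ρ g * koetheNorm ρ f.toAEEqFun := fun f =>
    lintegral_mul_le_koetheNorm_mul hsmul (hfin f) hg
  have hint : ∀ f : KoetheDual ρ, Integrable (fun x => f.toAEEqFun x * g x) μ := fun f =>
    ⟨(f.toAEEqFun.measurable.mul g.measurable).aestronglyMeasurable,
      (hle f).trans_lt (ENNReal.mul_lt_top hg.lt_top (hfin f).lt_top)⟩
  let L₀ : KoetheDual ρ →ₗ[ℝ] ℝ :=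
    { toFun := fun f => ∫ x, f.toAEEqFun x * g x ∂μ
      map_add' := fun f₁ f₂ => by
        rw [← integral_add (hint f₁) (hint f₂)]
        refine integral_congr_ae ?_
        filter_upwards [KoetheDual.coeFn_add f₁ f₂] with x hx
        rw [hx, add_mul]
      map_smul' := fun c f => by
        rw [RingHom.id_apply, smul_eq_mul, ← integral_const_mul]
        refine integral_congr_ae ?_
        filter_upwards [KoetheDual.coeFn_smul c f] with x hx
        rw [hx, mul_assoc] }
  have hbound : ∀ f, ‖L₀ f‖ ≤ (ρ g).toReal * ‖f‖ := fun f => by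
    rw [KoetheDual.norm_def, ← ENNReal.toReal_mul]
    refine (norm_integral_le_lintegral_norm _).trans ?_
    simp only [ofReal_norm]
    exact ENNReal.toReal_mono (ENNReal.mul_ne_top hg (hfin f)) (hle f)
  exact ⟨L₀.mkContinuous _ hbound, fun f => ⟨hint f, rfl⟩,
    LinearMap.mkContinuous_norm_le _ ENNReal.toReal_nonneg hbound⟩

theorem Represents.koetheNorm_koetheNorm_le {L : StrongDual ℝ (KoetheDual ρ)} {g : Ω →ₘ[μ] ℝ}
    (h : Represents L g) : koetheNorm (koetheNorm ρ) g ≤ ENNReal.ofReal ‖L‖ := by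
  refine iSup₂_le fun f hf => ?_
  classical
  let u : Ω → ℝ := fun x => |f x| * if 0 ≤ g x then 1 else -1
  have hum : Measurable u := f.measurable.abs.mul
    (Measurable.ite (measurableSet_le measurable_const g.measurable)
      measurable_const measurable_const)
  have hu : ∀ x, ‖u x‖ₑ = ‖f x‖ₑ ∧ u x * g x = |g x * f x| := by
    intro x
    simp only [u]
    rw [abs_mul]
    split_ifs with hx
    · refine ⟨by rw [mul_one, Real.enorm_abs], by rw [abs_of_nonneg hx]; ring⟩
    · refine ⟨by rw [mul_neg_one, enorm_neg, Real.enorm_abs], ?_⟩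
      rw [abs_of_neg (not_le.1 hx)]; ring
  have hun : dualNorm ρ (fun x => ‖u x‖ₑ) ≤ 1 := by
    simpa only [(hu _).1, ← koetheNorm_eq_dualNorm] using hf
  have hut : dualNorm ρ (fun x => ‖u x‖ₑ) ≠ ∞ := (hun.trans_lt ENNReal.one_lt_top).ne
  obtain ⟨hi, hL⟩ := h (KoetheDual.ofFun u hum hut)
  have hae : ∀ᵐ x ∂μ, (KoetheDual.ofFun u hum hut).toAEEqFun x * g x = |g x * f x| := by
    filter_upwards [KoetheDual.coeFn_ofFun hum hut] with x hx
    rw [hx, (hu x).2]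
  rw [integral_congr_ae hae] at hL
  have hi' := hi.congr hae
  rw [← ofReal_integral_eq_lintegral_ofReal hi' (Eventually.of_forall fun x => abs_nonneg _), ← hL]
  refine ENNReal.ofReal_le_ofReal ((le_abs_self _).trans ((L.le_opNorm _).trans ?_))
  rw [KoetheDual.norm_ofFun]
  exact mul_le_of_le_one_right (norm_nonneg _)
    (ENNReal.toReal_le_of_le_ofReal zero_le_one (by simpa using hun))

theorem Represents.unique {φ : Ω → ℝ} (hφ : Measurable φ)
    (hpos : ∀ x, 0 < φ x) (hfin : dualNorm ρ (fun x => ‖φ x‖ₑ) ≠ ∞)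
    {L : StrongDual ℝ (KoetheDual ρ)} {g₁ g₂ : Ω →ₘ[μ] ℝ} (h₁ : Represents L g₁)
    (h₂ : Represents L g₂) : g₁ = g₂ := by
  have hae : ∀ (g : Ω →ₘ[μ] ℝ) (s : SimpleFunc Ω ℝ), ∀ᵐ x ∂μ,
      (simpleFuncMul hφ hfin s).toAEEqFun x * g x = s x * (φ x * g x) := fun g s => by
    filter_upwards [coeFn_simpleFuncMul hφ hfin s] with x hx
    rw [hx, mul_assoc]
  have hint : ∀ g, Represents L g → Integrable (fun x => φ x * g x) μ := fun g hg => by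
    simpa using (hg (simpleFuncMul hφ hfin (SimpleFunc.const Ω 1))).1.congr (hae g _)
  have hset : ∀ g, Represents L g → ∀ A (hA : MeasurableSet A), ∫ x in A, φ x * g x ∂μ =
      L (simpleFuncMul hφ hfin (simpleIndicator hA)) := fun g hg A hA => by
    rw [(hg _).2, integral_congr_ae (hae g _), ← integral_indicator hA]
    congr 1
    ext x
    rw [simpleIndicator_apply]
    by_cases hx : x ∈ A <;> simp [hx]
  have := Integrable.ae_eq_of_forall_setIntegral_eq _ _ (hint g₁ h₁) (hint g₂ h₂)
    fun A hA _ => (hset g₁ h₁ A hA).trans (hset g₂ h₂ A hA).symm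
  refine AEEqFun.ext ?_
  filter_upwards [this] with x hx
  exact mul_left_cancel₀ (hpos x).ne' hx

/-- The duality `(X')* ≈ X` for quasi-norms with a disjoint estimate that are controlled by their
second associate. -/
theorem HasDisjointEstimate.koetheDualIso [SigmaFinite μ] {κ : ℝ≥0∞}
    (h : HasDisjointEstimate ρ κ) (hκ : κ < 2)
    (hsmul : ∀ t : ℝ, 0 < t → ∀ g, ρ (t • g) ≤ ENNReal.ofReal t * ρ g)
    {D : ℕ → Set Ω} (hD : ∀ k, MeasurableSet (D k)) (hcover : ⋃ k, D k = univ)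
    (hDfin : ∀ k, dualNorm ρ ((D k).indicator fun _ => 1) ≠ ∞)
    {c : ℝ} (hc : 1 ≤ c) (hbi : ∀ g, ρ g ≤ ENNReal.ofReal c * koetheNorm (koetheNorm ρ) g) :
    KoetheDualIso ρ ρ c := by
  obtain ⟨φ, hφ, hpos, hfin⟩ := exists_pos_dualNorm_ne_top hD hcover hDfin
  have hnorm : ∀ {L : StrongDual ℝ (KoetheDual ρ)} {g : Ω →ₘ[μ] ℝ}, Represents L g →
      ρ g ≤ ENNReal.ofReal (c * ‖L‖) := fun {L g} hL => by
    rw [ENNReal.ofReal_mul (zero_le_one.trans hc)]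
    refine (hbi g).trans ?_
    gcongr
    exact hL.koetheNorm_koetheNorm_le
  refine ⟨fun L => ?_, fun g hg => ?_⟩
  · obtain ⟨g, hg⟩ := h.exists_represents hκ hφ hpos hfin L
    exact ⟨g, ⟨(hnorm hg).trans_lt ENNReal.ofReal_lt_top, hg⟩,
      fun g' hg' => hg'.2.unique hφ hpos hfin hg⟩
  · obtain ⟨L, hL, hLn⟩ := exists_functional_of_ne_top hsmul hg.ne
    refine ⟨L, hL, ?_, hLn.trans (le_mul_of_one_le_left ENNReal.toReal_nonneg hc)⟩
    rw [inv_mul_le_iff₀ (zero_lt_one.trans_le hc)]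
    exact ENNReal.toReal_le_of_le_ofReal
      (mul_nonneg (zero_le_one.trans hc) (norm_nonneg _)) (hnorm hL)

end KoetheDualIso

section Lorentz

variable {Ω : Type*} [MeasurableSpace Ω] {μ : Measure Ω} {p q : ℝ}

theorem measurable_distribution (μ : Measure Ω) (f : Ω → ℝ) :
    Measurable (fun t : ℝ => μ {x | t < |f x|}) :=
  Antitone.measurable fun _ _ hst => measure_mono fun _ hx => lt_of_le_of_lt hst hx

/-- The integral `∫₀^∞ μ{|f| > t}^(q/p) t^q dt/t` in the Lorentz quasi-norm. -/
noncomputable def lorentzIntegral (μ : Measure Ω) (p q : ℝ) (f : Ω → ℝ) : ℝ≥0∞ :=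
  ∫⁻ t in Ioi (0 : ℝ), μ {x | t < |f x|} ^ (q / p) * ENNReal.ofReal (t ^ q / t)

theorem measurable_lorentzIntegrand (μ : Measure Ω) (p q : ℝ) (f : Ω → ℝ) :
    Measurable (fun t : ℝ => μ {x | t < |f x|} ^ (q / p) * ENNReal.ofReal (t ^ q / t)) :=
  ((measurable_distribution μ f).pow_const _).mul (by fun_prop)

theorem lorentzNorm_rpow (hq : 0 < q) (f : Ω → ℝ) :
    lorentzNorm μ p q f ^ q = ENNReal.ofReal p * lorentzIntegral μ p q f := by
  rw [lorentzNorm, ENNReal.mul_rpow_of_nonneg _ _ hq.le, ← ENNReal.rpow_mul, ← ENNReal.rpow_mul,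
    one_div_mul_cancel hq.ne', ENNReal.rpow_one, ENNReal.rpow_one, lorentzIntegral]

theorem lorentzNorm_mono_ae (hp : 0 < p) (hq : 0 < q) {f g : Ω → ℝ}
    (h : ∀ᵐ x ∂μ, |f x| ≤ |g x|) : lorentzNorm μ p q f ≤ lorentzNorm μ p q g := by
  have : ∀ t : ℝ, μ {x | t < |f x|} ≤ μ {x | t < |g x|} := fun t =>
    measure_mono_ae (h.mono fun x hx (ht : t < |f x|) => lt_of_lt_of_le ht hx)
  unfold lorentzNorm
  refine mul_le_mul_right (ENNReal.rpow_le_rpow (lintegral_mono fun t => ?_) (by positivity)) _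
  exact mul_le_mul_left (ENNReal.rpow_le_rpow (this t) (by positivity)) _

theorem lintegral_Ioi_comp_mul_left {c : ℝ} (hc : 0 < c) {F : ℝ → ℝ≥0∞} (hF : Measurable F) :
    ∫⁻ t in Ioi (0 : ℝ), F t = ENNReal.ofReal c * ∫⁻ t in Ioi (0 : ℝ), F (c * t) := by
  have hm : Measurable fun t : ℝ => c * t := measurable_const_mul c
  rw [← lintegral_indicator measurableSet_Ioi, ← lintegral_indicator measurableSet_Ioi]
  conv_lhs => rw [← Real.smul_map_volume_mul_left hc.ne']
  rw [lintegral_smul_measure, lintegral_map (hF.indicator measurableSet_Ioi) hm, abs_of_pos hc,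
    smul_eq_mul]
  congr 1
  refine lintegral_congr fun t => ?_
  by_cases ht : 0 < t
  · rw [indicator_of_mem (mem_Ioi.2 ht), indicator_of_mem (mem_Ioi.2 (mul_pos hc ht))]
  · rw [indicator_of_notMem (s := Ioi (0 : ℝ)) (a := t) (fun h => ht h),
      indicator_of_notMem (s := Ioi (0 : ℝ)) (a := c * t) (fun h => ht ((mul_pos_iff_of_pos_left hc).1 h))]

theorem lorentzIntegral_const_mul {c : ℝ} (hc : 0 < c) (f : Ω → ℝ) :
    lorentzIntegral μ p q (fun x => c * f x) =
      ENNReal.ofReal (c ^ q) * lorentzIntegral μ p q f := by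
  unfold lorentzIntegral
  rw [lintegral_Ioi_comp_mul_left hc (measurable_lorentzIntegrand μ p q _),
    ← lintegral_const_mul _ (measurable_lorentzIntegrand μ p q f),
    ← lintegral_const_mul' _ _ ENNReal.ofReal_ne_top]
  refine setLIntegral_congr_fun measurableSet_Ioi fun t (ht : 0 < t) => ?_
  have h1 : {x | c * t < |c * f x|} = {x | t < |f x|} := by
    ext x
    simp only [mem_ofPred_eq, abs_mul, abs_of_pos hc, mul_lt_mul_iff_right₀ hc]
  simp only [h1]
  rw [mul_left_comm, ← ENNReal.ofReal_mul hc.le, mul_left_comm (ENNReal.ofReal (c ^ q)),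
    ← ENNReal.ofReal_mul (by positivity), Real.mul_rpow hc.le ht.le]
  congr 2
  field_simp

theorem lorentzNorm_const_mul (hq : 0 < q) {c : ℝ} (hc : 0 < c) (f : Ω → ℝ) :
    lorentzNorm μ p q (fun x => c * f x) = ENNReal.ofReal c * lorentzNorm μ p q f := by
  have : ∀ g : Ω → ℝ, lorentzNorm μ p q g =
      ENNReal.ofReal p ^ (1 / q) * lorentzIntegral μ p q g ^ (1 / q) := fun g => rfl
  rw [this, this, lorentzIntegral_const_mul hc, ENNReal.mul_rpow_of_nonneg _ _ (by positivity),
    ← ENNReal.ofReal_rpow_of_pos hc, ← ENNReal.rpow_mul, mul_one_div_cancel hq.ne',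
    ENNReal.rpow_one]
  ring

/-- The constant in the upper estimate of `L^{p,q}` on two disjoint functions. -/
noncomputable def lorentzDisjointConst (p q : ℝ) : ℝ≥0∞ := 2 ^ ((max (q / p - 1) 0 + 1) / q)

theorem lorentzDisjointConst_lt_two (hp : 1 < p) (hq : 1 < q) : lorentzDisjointConst p q < 2 := by
  have hq0 : 0 < q := zero_lt_one.trans hq
  have h : (max (q / p - 1) 0 + 1) / q < 1 := by
    rw [div_lt_one hq0, ← lt_sub_iff_add_lt, max_lt_iff]
    exact ⟨sub_lt_sub_right (div_lt_self hq0 hp) 1, by linarith⟩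
  calc lorentzDisjointConst p q < 2 ^ (1 : ℝ) :=
        ENNReal.rpow_lt_rpow_of_exponent_lt (by norm_num) (by norm_num) h
    _ = 2 := ENNReal.rpow_one 2

theorem ENNReal.add_rpow_le {z : ℝ} (hz : 0 ≤ z) (a b : ℝ≥0∞) :
    (a + b) ^ z ≤ 2 ^ max (z - 1) 0 * (a ^ z + b ^ z) := by
  rcases le_total 1 z with h | h
  · rw [max_eq_left (by linarith)]
    exact ENNReal.rpow_add_le_mul_rpow_add_rpow a b h
  · rw [max_eq_right (by linarith), ENNReal.rpow_zero, one_mul]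
    exact ENNReal.rpow_add_le_add_rpow a b hz h

theorem lorentzNorm_le_of_disjoint (hp : 0 < p) (hq : 0 < q) {u v w : Ω → ℝ}
    (h : ∀ᵐ x ∂μ, |w x| ≤ |u x| ∨ |w x| ≤ |v x|) {B : ℝ≥0∞} (hu : lorentzNorm μ p q u ≤ B)
    (hv : lorentzNorm μ p q v ≤ B) : lorentzNorm μ p q w ≤ lorentzDisjointConst p q * B := by
  have h1 : ∀ t : ℝ, μ {x | t < |w x|} ≤ μ {x | t < |u x|} + μ {x | t < |v x|} := fun t => by
    refine le_trans (measure_mono_ae ?_) (measure_union_le _ _)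
    filter_upwards [h] with x hx
    exact fun (ht : t < |w x|) => hx.imp (fun h => lt_of_lt_of_le ht h)
      (fun h => lt_of_lt_of_le ht h)
  set m := max (q / p - 1) 0 with hm
  have h2 : lorentzIntegral μ p q w ≤
      2 ^ m * (lorentzIntegral μ p q u + lorentzIntegral μ p q v) := by
    unfold lorentzIntegral
    rw [← lintegral_add_left (measurable_lorentzIntegrand μ p q u),
      ← lintegral_const_mul' _ _ (ENNReal.rpow_ne_top_of_nonneg (le_max_right _ _)
        ENNReal.ofNat_ne_top)]
    refine lintegral_mono fun t => ?_
    rw [← add_mul, ← mul_assoc]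
    gcongr
    exact (ENNReal.rpow_le_rpow (h1 t) (by positivity)).trans
      (ENNReal.add_rpow_le (by positivity) _ _)
  have h3 : lorentzNorm μ p q w ^ q ≤ 2 ^ (m + 1) * B ^ q := by
    calc lorentzNorm μ p q w ^ q
        ≤ ENNReal.ofReal p * (2 ^ m * (lorentzIntegral μ p q u + lorentzIntegral μ p q v)) := by
          rw [lorentzNorm_rpow hq]; gcongr
      _ = 2 ^ m * (lorentzNorm μ p q u ^ q + lorentzNorm μ p q v ^ q) := by
          rw [lorentzNorm_rpow hq, lorentzNorm_rpow hq]; ring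
      _ ≤ 2 ^ m * (B ^ q + B ^ q) := by gcongr
      _ = _ := by
          rw [← two_mul, ← mul_assoc, ENNReal.rpow_add _ _ (by norm_num) (by norm_num),
            ENNReal.rpow_one]
  rw [← ENNReal.rpow_le_rpow_iff hq, ENNReal.mul_rpow_of_nonneg _ _ hq.le, lorentzDisjointConst,
    ← ENNReal.rpow_mul, div_mul_cancel₀ _ hq.ne']
  exact h3

/-- The Fatou property of the Lorentz quasi-norm along increasing sets. -/
theorem lorentzNorm_le_of_forall_indicator_le (hp : 0 < p) (hq : 0 < q) {f : Ω → ℝ}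
    {E : ℕ → Set Ω} (hmono : Monotone E) (hE : ⋃ k, E k = univ) {B : ℝ≥0∞}
    (h : ∀ k, lorentzNorm μ p q ((E k).indicator f) ≤ B) : lorentzNorm μ p q f ≤ B := by
  have hz : 0 < q / p := div_pos hq hp
  have hsets : ∀ t : ℝ, 0 < t → {x | t < |f x|} = ⋃ k, {x | t < |(E k).indicator f x|} := by
    intro t ht
    ext x
    simp only [mem_ofPred_eq, mem_iUnion]
    constructor
    · intro hx
      obtain ⟨k, hk⟩ := mem_iUnion.1 (hE ▸ mem_univ x : x ∈ ⋃ k, E k)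
      exact ⟨k, by rwa [indicator_of_mem hk]⟩
    · rintro ⟨k, hk⟩
      by_cases hx : x ∈ E k
      · rwa [indicator_of_mem hx] at hk
      · rw [indicator_of_notMem hx, abs_zero] at hk
        exact absurd hk ht.le.not_gt
  have hsm : ∀ t : ℝ, 0 < t → Monotone fun k => {x | t < |(E k).indicator f x|} := by
    intro t ht i j hij x (hx : t < |(E i).indicator f x|)
    by_cases hxi : x ∈ E i
    · rw [indicator_of_mem hxi] at hx
      rwa [mem_ofPred_eq, indicator_of_mem (hmono hij hxi)]
    · rw [indicator_of_notMem hxi, abs_zero] at hx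
      exact absurd hx ht.le.not_gt
  have hI : lorentzIntegral μ p q f ≤ ⨆ k, lorentzIntegral μ p q ((E k).indicator f) := by
    unfold lorentzIntegral
    rw [← lintegral_iSup' (fun k => (measurable_lorentzIntegrand μ p q _).aemeasurable)]
    · refine setLIntegral_mono' measurableSet_Ioi fun t (ht : 0 < t) => ?_
      rw [← ENNReal.iSup_mul, hsets t ht, (hsm t ht).measure_iUnion]
      gcongr
      rw [(ENNReal.monotone_rpow_of_nonneg hz.le).map_iSup_of_continuousAt
        ENNReal.continuous_rpow_const.continuousAt]
      simp [hz]
    · filter_upwards [ae_restrict_mem measurableSet_Ioi] with t ht i j hij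
      have := measure_mono (μ := μ) (hsm t ht hij)
      simp only
      gcongr
  rw [← ENNReal.rpow_le_rpow_iff hq, lorentzNorm_rpow hq]
  refine (mul_le_mul_right hI _).trans ?_
  rw [ENNReal.mul_iSup]
  refine iSup_le fun k => ?_
  rw [← lorentzNorm_rpow hq]
  exact ENNReal.rpow_le_rpow (h k) hq.le

theorem lorentzNorm_ne_top_of_bounded (hp : 0 < p) (hq : 0 < q) {f : Ω → ℝ} {C : ℝ}
    (hC : ∀ x, |f x| ≤ C) (hf : μ {x | f x ≠ 0} ≠ ∞) : lorentzNorm μ p q f ≠ ∞ := by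
  have hbound : lorentzIntegral μ p q f ≤
      μ {x | f x ≠ 0} ^ (q / p) * ∫⁻ t in Ioc 0 (max C 0), ENNReal.ofReal (t ^ (q - 1)) := by
    unfold lorentzIntegral
    rw [← lintegral_const_mul _ (by fun_prop), ← lintegral_indicator measurableSet_Ioi,
      ← lintegral_indicator measurableSet_Ioc]
    refine lintegral_mono fun t => ?_
    by_cases ht : 0 < t
    · rw [indicator_of_mem (mem_Ioi.2 ht)]
      by_cases htC : t ≤ C
      · rw [indicator_of_mem (mem_Ioc.2 ⟨ht, le_max_of_le_left htC⟩), Real.rpow_sub_one ht.ne']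
        gcongr
        intro (hx : t < |f _|) h0
        rw [h0, abs_zero] at hx
        exact absurd hx ht.le.not_gt
      · have : {x | t < |f x|} = ∅ :=
          eq_empty_of_forall_notMem fun x (hx : t < |f x|) => htC (hx.le.trans (hC x))
        rw [this, measure_empty, ENNReal.zero_rpow_of_pos (div_pos hq hp), zero_mul]
        exact zero_le
    · rw [indicator_of_notMem (s := Ioi (0 : ℝ)) (fun h => ht h)]
      exact zero_le
  have hfin : ∫⁻ t in Ioc 0 (max C 0), ENNReal.ofReal (t ^ (q - 1)) ≠ ∞ := by
    have hi : IntegrableOn (fun t : ℝ => t ^ (q - 1)) (Ioc 0 (max C 0)) := by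
      rw [← intervalIntegrable_iff_integrableOn_Ioc_of_le (le_max_right _ _)]
      exact intervalIntegral.intervalIntegrable_rpow' (by linarith)
    exact (lt_of_le_of_lt (lintegral_mono fun t => Real.ofReal_le_enorm _) hi.2).ne
  have hI : lorentzIntegral μ p q f ≠ ∞ := ne_top_of_le_ne_top
    (ENNReal.mul_ne_top (ENNReal.rpow_ne_top_of_nonneg (by positivity) hf) hfin) hbound
  exact ENNReal.mul_ne_top (ENNReal.rpow_ne_top_of_nonneg (by positivity) ENNReal.ofReal_ne_top)
    (ENNReal.rpow_ne_top_of_nonneg (by positivity) hI)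

end Lorentz

section LorentzDuality

variable {Ω : Type*} [MeasurableSpace Ω] {μ : Measure Ω} {p q : ℝ}

theorem ENNReal.rpow_sub_one_mul_self {a : ℝ≥0∞} (ha : a ≠ ∞) {z : ℝ} (hz : 0 < z) :
    a ^ (z - 1) * a = a ^ z := by
  rcases eq_or_ne a 0 with rfl | h0
  · rw [mul_zero, ENNReal.zero_rpow_of_pos hz]
  · conv_lhs => rw [← ENNReal.rpow_one a, ← ENNReal.rpow_mul, one_mul,
      ← ENNReal.rpow_add _ _ h0 ha, sub_add_cancel]

theorem ENNReal.rpow_sub_one_mul_min_le {a b D : ℝ≥0∞} (ha : a ≠ ∞) (hD : 1 ≤ D) (hDt : D ≠ ∞)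
    {z ξ : ℝ} (hz : 0 < z) (hξ : 0 < ξ) :
    a ^ (z - 1) * min a b ≤ a ^ z * D ^ (-ξ) + b ^ z * D ^ (ξ * max (z - 1) 0) := by
  have hD0 : D ≠ 0 := (zero_lt_one.trans_le hD).ne'
  rcases le_or_gt b (a * D ^ (-ξ)) with hb | hb
  · refine le_add_right ?_
    calc a ^ (z - 1) * min a b ≤ a ^ (z - 1) * (a * D ^ (-ξ)) := by
          gcongr; exact (min_le_right _ _).trans hb
      _ = _ := by rw [← mul_assoc, ENNReal.rpow_sub_one_mul_self ha hz]
  refine le_add_left ?_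
  rcases eq_or_ne b ∞ with rfl | hbt
  · rw [ENNReal.top_rpow_of_pos hz, ENNReal.top_mul]
    · exact le_top
    · exact (ENNReal.rpow_pos (pos_iff_ne_zero.2 hD0) hDt).ne'
  rcases le_total 1 z with h1 | h1
  · rw [max_eq_left (by linarith)]
    have hab : a ≤ b * D ^ ξ := by
      rw [ENNReal.rpow_neg, ← div_eq_mul_inv] at hb
      exact (ENNReal.div_le_iff_le_mul
        (Or.inl (ENNReal.rpow_pos (pos_iff_ne_zero.2 hD0) hDt).ne')
        (Or.inl (ENNReal.rpow_ne_top_of_nonneg hξ.le hDt))).1 hb.le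
    calc a ^ (z - 1) * min a b ≤ (b * D ^ ξ) ^ (z - 1) * b :=
          mul_le_mul' (ENNReal.rpow_le_rpow hab (by linarith)) (min_le_right _ _)
      _ = (b ^ (z - 1) * b) * D ^ (ξ * (z - 1)) := by
          rw [ENNReal.mul_rpow_of_nonneg _ _ (by linarith), ← ENNReal.rpow_mul]; ring
      _ = _ := by rw [ENNReal.rpow_sub_one_mul_self hbt hz]
  · rw [max_eq_right (by linarith), mul_zero, ENNReal.rpow_zero, mul_one]
    rcases le_total a b with hab | hab
    · rw [min_eq_left hab, ENNReal.rpow_sub_one_mul_self ha hz]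
      exact ENNReal.rpow_le_rpow hab hz.le
    · rw [min_eq_right hab, ← ENNReal.rpow_sub_one_mul_self hbt hz]
      gcongr ?_ * _
      rw [← neg_sub 1 z, ENNReal.rpow_neg, ENNReal.rpow_neg]
      exact ENNReal.inv_le_inv.2 (ENNReal.rpow_le_rpow hab (by linarith))

theorem setLIntegral_enorm_eq_lintegral_meas {u : Ω → ℝ} (hu : Measurable u) (E : Set Ω) :
    ∫⁻ x in E, ‖u x‖ₑ ∂μ = ∫⁻ s in Ioi (0 : ℝ), μ ({x | s < |u x|} ∩ E) := by
  simp only [Real.enorm_eq_ofReal_abs]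
  rw [lintegral_eq_lintegral_meas_lt _ (Eventually.of_forall fun x => abs_nonneg _)
    hu.abs.aemeasurable]
  refine lintegral_congr fun s => ?_
  rw [Measure.restrict_apply (measurableSet_lt measurable_const hu.abs)]

/-- The function `x ↦ ∫₀^{|f(x)|} t^(q-2) μ{|f| > t}^(q/p-1) dt`, which norms `f ∈ L^{p,q}` up to
constants. -/
noncomputable def lorentzDual (μ : Measure Ω) (p q : ℝ) (f : Ω → ℝ) (x : Ω) : ℝ≥0∞ :=
  ∫⁻ t in Ioi (0 : ℝ), {t : ℝ | t < |f x|}.indicator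
    (fun t => ENNReal.ofReal (t ^ (q - 2)) * μ {x | t < |f x|} ^ (q / p - 1)) t

theorem measurable_lorentzWeight (μ : Measure Ω) (p q : ℝ) (f : Ω → ℝ) : Measurable fun t : ℝ =>
    ENNReal.ofReal (t ^ (q - 2)) * μ {x | t < |f x|} ^ (q / p - 1) :=
  Measurable.mul (by fun_prop) ((measurable_distribution μ f).pow_const _)

theorem measurable_lorentzDual_integrand (μ : Measure Ω) (p q : ℝ) {f : Ω → ℝ}
    (hf : Measurable f) :
    Measurable fun z : Ω × ℝ => {t : ℝ | t < |f z.1|}.indicator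
      (fun t => ENNReal.ofReal (t ^ (q - 2)) * μ {x | t < |f x|} ^ (q / p - 1)) z.2 := by
  have hS : MeasurableSet {z : Ω × ℝ | z.2 < |f z.1|} :=
    measurableSet_lt measurable_snd (hf.comp measurable_fst).abs
  exact ((measurable_lorentzWeight μ p q f).comp measurable_snd).indicator hS

theorem measurable_lorentzDual (μ : Measure Ω) (p q : ℝ) {f : Ω → ℝ} (hf : Measurable f) :
    Measurable (lorentzDual μ p q f) :=
  (measurable_lorentzDual_integrand μ p q hf).lintegral_prod_right'

theorem lintegral_mul_lorentzDual [SFinite μ] {f : Ω → ℝ} (hf : Measurable f) {G : Ω → ℝ≥0∞}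
    (hG : Measurable G) :
    ∫⁻ x, G x * lorentzDual μ p q f x ∂μ = ∫⁻ t in Ioi (0 : ℝ),
      ENNReal.ofReal (t ^ (q - 2)) * μ {x | t < |f x|} ^ (q / p - 1) *
        ∫⁻ x in {x | t < |f x|}, G x ∂μ := by
  have hm := measurable_lorentzDual_integrand μ p q hf
  have h1 : ∀ x, G x * lorentzDual μ p q f x = ∫⁻ t in Ioi (0 : ℝ), G x *
      {t : ℝ | t < |f x|}.indicator
        (fun t => ENNReal.ofReal (t ^ (q - 2)) * μ {x | t < |f x|} ^ (q / p - 1)) t := fun x =>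
    (lintegral_const_mul _ (hm.comp measurable_prodMk_left)).symm
  simp only [h1]
  rw [lintegral_lintegral_swap ((hG.comp measurable_fst).mul hm).aemeasurable]
  refine lintegral_congr fun t => ?_
  have hS : MeasurableSet {x | t < |f x|} := measurableSet_lt measurable_const hf.abs
  rw [← lintegral_const_mul _ hG, ← lintegral_indicator hS]
  refine lintegral_congr fun x => ?_
  by_cases hx : t < |f x|
  · rw [indicator_of_mem (s := {t : ℝ | t < |f x|}) hx,
      indicator_of_mem (s := {x | t < |f x|}) hx, mul_comm]
  · rw [indicator_of_notMem (s := {t : ℝ | t < |f x|}) hx,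
      indicator_of_notMem (s := {x | t < |f x|}) hx, mul_zero]

theorem lorentzIntegral_le_lintegral_mul_lorentzDual [SFinite μ] (hp : 0 < p) (hq : 0 < q)
    {f : Ω → ℝ} (hf : Measurable f) (hfin : ∀ t : ℝ, 0 < t → μ {x | t < |f x|} ≠ ∞) :
    lorentzIntegral μ p q f ≤ ∫⁻ x, ‖f x‖ₑ * lorentzDual μ p q f x ∂μ := by
  rw [lintegral_mul_lorentzDual hf hf.enorm]
  refine setLIntegral_mono' measurableSet_Ioi fun t (ht : 0 < t) => ?_
  have h1 : ENNReal.ofReal t * μ {x | t < |f x|} ≤ ∫⁻ x in {x | t < |f x|}, ‖f x‖ₑ ∂μ := by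
    rw [← setLIntegral_const]
    refine setLIntegral_mono' (measurableSet_lt measurable_const hf.abs) fun x hx => ?_
    rw [Real.enorm_eq_ofReal_abs]
    exact ENNReal.ofReal_le_ofReal (le_of_lt hx)
  refine le_trans (le_of_eq ?_) (mul_le_mul_right h1 _)
  rw [← ENNReal.rpow_sub_one_mul_self (hfin t ht) (div_pos hq hp),
    show t ^ q / t = t ^ (q - 2) * t by
      rw [← Real.rpow_sub_one ht.ne', ← Real.rpow_add_one ht.ne']; congr 1; ring,
    ENNReal.ofReal_mul (by positivity)]
  ring

theorem setLIntegral_Ioi_rpow_neg {ξ : ℝ} (hξ : 1 < ξ) {t : ℝ} (ht : 0 < t) :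
    ∫⁻ s in Ioi t, ENNReal.ofReal (s ^ (-ξ)) = ENNReal.ofReal (t ^ (1 - ξ) / (ξ - 1)) := by
  rw [← ofReal_integral_eq_lintegral_ofReal
    (integrableOn_Ioi_rpow_of_lt (by linarith) ht)
    ((ae_restrict_mem measurableSet_Ioi).mono fun s hs =>
      Real.rpow_nonneg (ht.trans hs).le _),
    integral_Ioi_rpow_of_lt (by linarith) ht]
  congr 1
  rw [show -ξ + 1 = -(ξ - 1) by ring, neg_div_neg_eq, neg_sub]

theorem setLIntegral_Ioo_rpow {r : ℝ} (hr : -1 < r) {s : ℝ} (hs : 0 < s) :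
    ∫⁻ t in Ioo 0 s, ENNReal.ofReal (t ^ r) = ENNReal.ofReal (s ^ (r + 1) / (r + 1)) := by
  have hi : IntegrableOn (fun t : ℝ => t ^ r) (Ioc 0 s) := by
    rw [← intervalIntegrable_iff_integrableOn_Ioc_of_le hs.le]
    exact intervalIntegral.intervalIntegrable_rpow' hr
  rw [setLIntegral_congr Ioo_ae_eq_Ioc, ← ofReal_integral_eq_lintegral_ofReal hi
    ((ae_restrict_mem measurableSet_Ioc).mono fun t ht => Real.rpow_nonneg ht.1.le _),
    ← intervalIntegral.integral_of_le hs.le, integral_rpow (Or.inl hr),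
    Real.zero_rpow (by linarith), sub_zero]

theorem exists_lintegral_mul_lorentzDual_le (hp : 1 < p) (hq : 1 < q) :
    ∃ C : ℝ, 0 < C ∧ ∀ (Ω : Type*) [MeasurableSpace Ω] (μ : Measure Ω) [SFinite μ] (f u : Ω → ℝ),
      Measurable f → Measurable u → (∀ t : ℝ, 0 < t → μ {x | t < |f x|} ≠ ∞) →
      ∫⁻ x, ‖u x‖ₑ * lorentzDual μ p q f x ∂μ ≤
        ENNReal.ofReal C * (lorentzIntegral μ p q f + lorentzIntegral μ p q u) := by
  have hp0 : 0 < p := zero_lt_one.trans hp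
  have hq0 : 0 < q := zero_lt_one.trans hq
  have hz : 0 < q / p := div_pos hq0 hp0
  obtain ⟨ξ, hξ, hξq⟩ : ∃ ξ : ℝ, 1 < ξ ∧ ξ * max (q / p - 1) 0 < q - 1 := by
    have hm : max (q / p - 1) 0 < q - 1 :=
      max_lt (sub_lt_sub_right (div_lt_self hq0 hp) 1) (by linarith)
    have hcont : Tendsto (fun ξ : ℝ => ξ * max (q / p - 1) 0) (𝓝[>] 1)
        (𝓝 (1 * max (q / p - 1) 0)) :=
      (tendsto_id.mul_const _).mono_left nhdsWithin_le_nhds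
    rw [one_mul] at hcont
    exact (eventually_mem_nhdsWithin.and (hcont.eventually_lt_const hm)).exists
  set ζ := ξ * max (q / p - 1) 0 with hζ
  have hζ0 : 0 ≤ ζ := mul_nonneg (by linarith) (le_max_right _ _)
  refine ⟨max (1 + 1 / (ξ - 1)) (1 / (q - 1 - ζ)), lt_max_of_lt_left ?_, ?_⟩
  · have : 0 < ξ - 1 := by linarith
    positivity
  intro Ω _ μ _ f u hf hu hfin
  rw [lintegral_mul_lorentzDual hf hu.enorm]
  set a : ℝ → ℝ≥0∞ := fun t => μ {x | t < |f x|} with ha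
  set b : ℝ → ℝ≥0∞ := fun s => μ {x | s < |u x|} with hb
  have ham : Measurable a := measurable_distribution μ f
  have hbm : Measurable b := measurable_distribution μ u
  let K₁ : ℝ → ℝ → ℝ≥0∞ := fun t s => (Iic t).indicator (fun _ => ENNReal.ofReal (t ^ (q - 2))) s +
    (Ioi t).indicator (fun s => ENNReal.ofReal (t ^ (q - 2 + ξ)) * ENNReal.ofReal (s ^ (-ξ))) s
  let K₂ : ℝ → ℝ → ℝ≥0∞ := fun t s =>
    (Iio s).indicator (fun t => ENNReal.ofReal (s ^ ζ) * ENNReal.ofReal (t ^ (q - 2 - ζ))) t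
  have hpt : ∀ t, 0 < t → ∀ s, 0 < s →
      ENNReal.ofReal (t ^ (q - 2)) * a t ^ (q / p - 1) * μ ({x | s < |u x|} ∩ {x | t < |f x|}) ≤
        a t ^ (q / p) * K₁ t s + b s ^ (q / p) * K₂ t s := by
    intro t ht s hs
    have hmin : μ ({x | s < |u x|} ∩ {x | t < |f x|}) ≤ min (a t) (b s) :=
      le_min (measure_mono inter_subset_right) (measure_mono inter_subset_left)
    refine (mul_le_mul_right hmin _).trans ?_
    rw [mul_assoc]
    rcases le_or_gt s t with hst | hst
    · refine le_add_right ?_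
      have hK : K₁ t s = ENNReal.ofReal (t ^ (q - 2)) := by
        simp only [K₁]
        rw [indicator_of_mem (mem_Iic.2 hst), indicator_of_notMem (notMem_Ioi.2 hst), add_zero]
      rw [hK]
      refine (mul_le_mul_right (mul_le_mul_right (min_le_left _ _) _) _).trans (le_of_eq ?_)
      rw [ENNReal.rpow_sub_one_mul_self (hfin t ht) hz, mul_comm]
    · have hK₁ : K₁ t s = ENNReal.ofReal (t ^ (q - 2)) * ENNReal.ofReal (s / t) ^ (-ξ) := by
        simp only [K₁]
        rw [indicator_of_notMem (notMem_Iic.2 hst), indicator_of_mem (mem_Ioi.2 hst), zero_add,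
          ENNReal.ofReal_rpow_of_pos (div_pos hs ht), ← ENNReal.ofReal_mul (by positivity),
          ← ENNReal.ofReal_mul (by positivity), Real.div_rpow hs.le ht.le, Real.rpow_add ht,
          Real.rpow_neg ht.le ξ, div_inv_eq_mul]
        congr 1; ring
      have hK₂ : K₂ t s = ENNReal.ofReal (t ^ (q - 2)) * ENNReal.ofReal (s / t) ^ ζ := by
        simp only [K₂]
        rw [indicator_of_mem (mem_Iio.2 hst), ENNReal.ofReal_rpow_of_pos (div_pos hs ht),
          ← ENNReal.ofReal_mul (by positivity), ← ENNReal.ofReal_mul (by positivity),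
          Real.div_rpow hs.le ht.le, Real.rpow_sub ht]
        congr 1; ring
      have := ENNReal.rpow_sub_one_mul_min_le (b := b s) (hfin t ht)
        (D := ENNReal.ofReal (s / t)) (by
          rw [ENNReal.one_le_ofReal]; exact (one_le_div ht).2 hst.le)
        ENNReal.ofReal_ne_top hz (zero_lt_one.trans hξ)
      rw [hK₁, hK₂]
      refine (mul_le_mul_right this _).trans (le_of_eq ?_)
      ring
  have hK₁m : Measurable (Function.uncurry K₁) := by
    refine Measurable.add ?_ ?_
    · exact Measurable.indicator (s := {z : ℝ × ℝ | z.2 ≤ z.1})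
        (f := fun z => ENNReal.ofReal (z.1 ^ (q - 2))) (by fun_prop)
        (measurableSet_le measurable_snd measurable_fst)
    · exact Measurable.indicator (s := {z : ℝ × ℝ | z.1 < z.2})
        (f := fun z => ENNReal.ofReal (z.1 ^ (q - 2 + ξ)) * ENNReal.ofReal (z.2 ^ (-ξ)))
        (by fun_prop) (measurableSet_lt measurable_fst measurable_snd)
  have hK₂m : Measurable (Function.uncurry K₂) :=
    Measurable.indicator (s := {z : ℝ × ℝ | z.1 < z.2})
      (f := fun z => ENNReal.ofReal (z.2 ^ ζ) * ENNReal.ofReal (z.1 ^ (q - 2 - ζ)))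
      (by fun_prop) (measurableSet_lt measurable_fst measurable_snd)
  have hI₁ : ∀ t, 0 < t → ∫⁻ s in Ioi (0 : ℝ), K₁ t s =
      ENNReal.ofReal (1 + 1 / (ξ - 1)) * ENNReal.ofReal (t ^ q / t) := by
    intro t ht
    have hξ1 : 0 < ξ - 1 := by linarith
    simp only [K₁]
    rw [lintegral_add_left (measurable_const.indicator measurableSet_Iic),
      lintegral_indicator measurableSet_Iic, lintegral_indicator measurableSet_Ioi,
      Measure.restrict_restrict measurableSet_Iic, Measure.restrict_restrict measurableSet_Ioi,
      Iic_inter_Ioi, Ioi_inter_Ioi, sup_eq_left.2 ht.le,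
      lintegral_const_mul' _ _ ENNReal.ofReal_ne_top, setLIntegral_Ioi_rpow_neg hξ ht,
      setLIntegral_const, Real.volume_Ioc, sub_zero, ← ENNReal.ofReal_mul (by positivity),
      ← ENNReal.ofReal_mul (by positivity), ← ENNReal.ofReal_mul (by positivity),
      ← ENNReal.ofReal_add (by positivity) (by positivity)]
    congr 1
    have e1 : t ^ q / t = t ^ (q - 2) * t := by
      rw [← Real.rpow_sub_one ht.ne', ← Real.rpow_add_one ht.ne']; congr 1; ring
    have e2 : t ^ (q - 2 + ξ) * t ^ (1 - ξ) = t ^ (q - 2) * t := by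
      rw [← Real.rpow_add ht, ← Real.rpow_add_one ht.ne']; congr 1; ring
    rw [e1, ← mul_div_assoc, e2]
    ring
  have hI₂ : ∀ s, 0 < s → ∫⁻ t in Ioi (0 : ℝ), K₂ t s =
      ENNReal.ofReal (1 / (q - 1 - ζ)) * ENNReal.ofReal (s ^ q / s) := by
    intro s hs
    have hqζ : 0 < q - 1 - ζ := by linarith
    simp only [K₂]
    rw [lintegral_indicator measurableSet_Iio, Measure.restrict_restrict measurableSet_Iio,
      inter_comm, Ioi_inter_Iio, lintegral_const_mul' _ _ ENNReal.ofReal_ne_top,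
      setLIntegral_Ioo_rpow (by linarith) hs, show q - 2 - ζ + 1 = q - 1 - ζ by ring,
      ← ENNReal.ofReal_mul (by positivity), ← ENNReal.ofReal_mul (by positivity)]
    congr 1
    have e1 : s ^ ζ * s ^ (q - 1 - ζ) = s ^ q / s := by
      rw [← Real.rpow_add hs, ← Real.rpow_sub_one hs.ne']; congr 1; ring
    rw [← mul_div_assoc, e1]
    ring
  calc ∫⁻ t in Ioi (0 : ℝ), ENNReal.ofReal (t ^ (q - 2)) * a t ^ (q / p - 1) *
        ∫⁻ x in {x | t < |f x|}, ‖u x‖ₑ ∂μ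
      ≤ ∫⁻ t in Ioi (0 : ℝ), ∫⁻ s in Ioi (0 : ℝ),
          (a t ^ (q / p) * K₁ t s + b s ^ (q / p) * K₂ t s) := by
        refine setLIntegral_mono' measurableSet_Ioi fun t (ht : 0 < t) => ?_
        have hm : Measurable fun s : ℝ => μ ({x | s < |u x|} ∩ {x | t < |f x|}) :=
          Antitone.measurable fun s₁ s₂ h12 =>
            measure_mono (inter_subset_inter_left _ fun x hx => lt_of_le_of_lt h12 hx)
        rw [setLIntegral_enorm_eq_lintegral_meas hu, ← lintegral_const_mul _ hm]
        exact setLIntegral_mono' measurableSet_Ioi fun s (hs : 0 < s) => hpt t ht s hs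
    _ = (∫⁻ t in Ioi (0 : ℝ), ∫⁻ s in Ioi (0 : ℝ), a t ^ (q / p) * K₁ t s) +
        ∫⁻ t in Ioi (0 : ℝ), ∫⁻ s in Ioi (0 : ℝ), b s ^ (q / p) * K₂ t s := by
        have hm : Measurable fun z : ℝ × ℝ => a z.1 ^ (q / p) * K₁ z.1 z.2 :=
          ((ham.comp measurable_fst).pow_const _).mul hK₁m
        rw [← lintegral_add_left hm.lintegral_prod_right']
        refine lintegral_congr fun t => ?_
        have hmt : Measurable fun s => a t ^ (q / p) * K₁ t s := hm.comp measurable_prodMk_left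
        rw [← lintegral_add_left hmt]
    _ = ENNReal.ofReal (1 + 1 / (ξ - 1)) * lorentzIntegral μ p q f +
        ENNReal.ofReal (1 / (q - 1 - ζ)) * lorentzIntegral μ p q u := by
        congr 1
        · unfold lorentzIntegral
          rw [← lintegral_const_mul' _ _ ENNReal.ofReal_ne_top]
          refine setLIntegral_congr_fun measurableSet_Ioi fun t ht => ?_
          have hmt : Measurable fun s => K₁ t s := hK₁m.comp measurable_prodMk_left
          rw [lintegral_const_mul _ hmt, hI₁ t ht]
          ring
        · rw [lintegral_lintegral_swap
            (((hbm.comp measurable_snd).pow_const _).mul hK₂m).aemeasurable]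
          unfold lorentzIntegral
          rw [← lintegral_const_mul' _ _ ENNReal.ofReal_ne_top]
          refine setLIntegral_congr_fun measurableSet_Ioi fun s hs => ?_
          have hms : Measurable fun t => K₂ t s := hK₂m.comp measurable_prodMk_right
          rw [lintegral_const_mul _ hms, hI₂ s hs]
          ring
    _ ≤ _ := by
        rw [mul_add]
        gcongr
        · exact le_max_left _ _
        · exact le_max_right _ _

/-- Duality for the Lorentz quasi-norm with constant `c`, for functions with support of finite
measure: `f` is normed, up to `c`, by some `H` in the associate space of norm at most `c`. -/
def HasLorentzDuality (μ : Measure Ω) (p q c : ℝ) : Prop :=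
  ∀ f : Ω → ℝ, Measurable f → μ {x | f x ≠ 0} ≠ ∞ → lorentzNorm μ p q f ≠ ∞ →
    ∃ H : Ω → ℝ, Measurable H ∧
      (∀ u : Ω → ℝ, Measurable u →
        ∫⁻ x, ‖H x‖ₑ * ‖u x‖ₑ ∂μ ≤ ENNReal.ofReal c * lorentzNorm μ p q u) ∧
      lorentzNorm μ p q f ≤ ENNReal.ofReal c * ∫⁻ x, ‖H x‖ₑ * ‖f x‖ₑ ∂μ

/-- It is enough to norm functions of quasi-norm one by functions with values in `[0, ∞]`. -/
theorem HasLorentzDuality.of_normalized (hq : 0 < q) {c : ℝ} (hc : 0 < c)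
    (h : ∀ f : Ω → ℝ, Measurable f → μ {x | f x ≠ 0} ≠ ∞ → lorentzNorm μ p q f = 1 →
      ∃ H : Ω → ℝ≥0∞, Measurable H ∧
        (∀ u : Ω → ℝ, Measurable u → lorentzNorm μ p q u ≤ 1 →
          ∫⁻ x, H x * ‖u x‖ₑ ∂μ ≤ ENNReal.ofReal c) ∧
        1 ≤ ENNReal.ofReal c * ∫⁻ x, H x * ‖f x‖ₑ ∂μ) :
    HasLorentzDuality μ p q c := by
  intro f hf hsupp hfin
  rcases eq_or_ne (lorentzNorm μ p q f) 0 with h0 | h0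
  · exact ⟨fun _ => 0, measurable_const, fun u _ => by simp, by simp [h0]⟩
  set N := (lorentzNorm μ p q f).toReal with hN
  have hNpos : 0 < N := ENNReal.toReal_pos h0 hfin
  have hNf : ENNReal.ofReal N = lorentzNorm μ p q f := ENNReal.ofReal_toReal hfin
  have hf₁ : Measurable fun x => N⁻¹ * f x := hf.const_mul _
  have hnorm : lorentzNorm μ p q (fun x => N⁻¹ * f x) = 1 := by
    rw [lorentzNorm_const_mul hq (inv_pos.2 hNpos), ← hNf, ← ENNReal.ofReal_mul (by positivity),
      inv_mul_cancel₀ hNpos.ne', ENNReal.ofReal_one]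
  obtain ⟨H, hHm, hH, hHf⟩ := h _ hf₁ (by simpa [hNpos.ne'] using hsupp) hnorm
  have hHt : ∀ x, ‖(H x).toReal‖ₑ ≤ H x := fun x => by
    rw [Real.enorm_of_nonneg ENNReal.toReal_nonneg]; exact ENNReal.ofReal_toReal_le
  refine ⟨fun x => (H x).toReal, hHm.ennreal_toReal, fun u hu => ?_, ?_⟩
  · refine (lintegral_mono fun x => mul_le_mul_left (hHt x) _).trans ?_
    rcases eq_or_ne (lorentzNorm μ p q u) ∞ with hut | hut
    · rw [hut, ENNReal.mul_top (ENNReal.ofReal_pos.2 hc).ne']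
      exact le_top
    rw [mul_comm]
    refine ENNReal.le_mul_of_forall_ofReal_gt ENNReal.ofReal_ne_top (fun t ht hlt => ?_) hut
    have h1 : lorentzNorm μ p q (fun x => t⁻¹ * u x) ≤ 1 := by
      rw [lorentzNorm_const_mul hq (inv_pos.2 ht), ENNReal.ofReal_inv_of_pos ht, mul_comm,
        ← div_eq_mul_inv]
      exact ENNReal.div_le_of_le_mul (by rw [one_mul]; exact hlt.le)
    calc ∫⁻ x, H x * ‖u x‖ₑ ∂μ = ∫⁻ x, ENNReal.ofReal t * (H x * ‖t⁻¹ * u x‖ₑ) ∂μ := by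
          refine lintegral_congr fun x => ?_
          rw [mul_left_comm, ← Real.enorm_of_nonneg ht.le, ← enorm_mul, mul_inv_cancel_left₀ ht.ne']
      _ = ENNReal.ofReal t * ∫⁻ x, H x * ‖t⁻¹ * u x‖ₑ ∂μ :=
          lintegral_const_mul' _ _ ENNReal.ofReal_ne_top
      _ ≤ _ := by gcongr; exact hH _ (hu.const_mul _) h1
  · have hfinI : ∫⁻ x, H x * ‖N⁻¹ * f x‖ₑ ∂μ ≠ ∞ :=
      ((hH _ hf₁ hnorm.le).trans_lt ENNReal.ofReal_lt_top).ne
    have hae : ∀ᵐ x ∂μ, ‖(H x).toReal‖ₑ * ‖f x‖ₑ =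
        ENNReal.ofReal N * (H x * ‖N⁻¹ * f x‖ₑ) := by
      filter_upwards [ae_lt_top (hHm.mul hf₁.enorm) hfinI] with x hx
      rw [mul_left_comm, ← Real.enorm_of_nonneg hNpos.le, ← enorm_mul N,
        mul_inv_cancel_left₀ hNpos.ne']
      rcases eq_or_ne (f x) 0 with hfx | hfx
      · simp [hfx]
      · have : H x ≠ ∞ := fun hHx => by
          simp only [Pi.mul_apply, hHx] at hx
          rw [ENNReal.top_mul] at hx
          · exact lt_irrefl _ hx
          · simp [hNpos.ne', hfx]
        rw [Real.enorm_of_nonneg ENNReal.toReal_nonneg, ENNReal.ofReal_toReal this]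
    rw [lintegral_congr_ae hae, lintegral_const_mul' _ _ ENNReal.ofReal_ne_top, hNf, mul_left_comm]
    exact le_mul_of_one_le_right zero_le hHf

theorem exists_hasLorentzDuality [SFinite μ] (hp : 1 < p) (hq : 1 < q) :
    ∃ c : ℝ, 1 ≤ c ∧ HasLorentzDuality μ p q c := by
  have hp0 : 0 < p := zero_lt_one.trans hp
  have hq0 : 0 < q := zero_lt_one.trans hq
  obtain ⟨C, hC, hCle⟩ := exists_lintegral_mul_lorentzDual_le hp hq
  refine ⟨max p (C + C), hp.le.trans (le_max_left _ _),
    HasLorentzDuality.of_normalized hq0 (hp0.trans_le (le_max_left _ _)) fun f hf hsupp hfn => ?_⟩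
  have hfin : ∀ t : ℝ, 0 < t → μ {x | t < |f x|} ≠ ∞ := fun t ht =>
    ne_top_of_le_ne_top hsupp (measure_mono fun x (hx : t < |f x|) => by
      intro h0
      rw [h0, abs_zero] at hx
      exact absurd hx ht.le.not_gt)
  have hle : ∀ u : Ω → ℝ, lorentzNorm μ p q u ≤ 1 → lorentzIntegral μ p q u ≤ 1 := fun u hu => by
    have h1 := lorentzNorm_rpow (μ := μ) (p := p) hq0 u
    have h2 : ENNReal.ofReal p * lorentzIntegral μ p q u ≤ 1 := by
      rw [← h1]; exact ENNReal.rpow_le_one hu hq0.le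
    refine le_trans (le_mul_of_one_le_left zero_le ?_) h2
    exact ENNReal.one_le_ofReal.2 hp.le
  refine ⟨lorentzDual μ p q f, measurable_lorentzDual μ p q hf, fun u hu hun => ?_, ?_⟩
  · simp only [mul_comm (lorentzDual μ p q f _)]
    refine (hCle Ω μ f u hf hu hfin).trans ?_
    calc ENNReal.ofReal C * (lorentzIntegral μ p q f + lorentzIntegral μ p q u)
        ≤ ENNReal.ofReal C * (1 + 1) := by
          gcongr
          · exact hle f hfn.le
          · exact hle u hun
      _ = ENNReal.ofReal (C + C) := by rw [ENNReal.ofReal_add hC.le hC.le]; ring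
      _ ≤ _ := ENNReal.ofReal_le_ofReal (le_max_right _ _)
  · simp only [mul_comm (lorentzDual μ p q f _)]
    have h1 := lorentzNorm_rpow (μ := μ) (p := p) hq0 f
    rw [hfn, ENNReal.one_rpow] at h1
    rw [h1]
    gcongr
    · exact le_max_left _ _
    · exact lorentzIntegral_le_lintegral_mul_lorentzDual hp0 hq0 hf hfin

theorem lorentzNorm_self (hp : 0 < p) {f : Ω → ℝ} (hf : Measurable f) :
    lorentzNorm μ p p f = (∫⁻ x, ‖f x‖ₑ ^ p ∂μ) ^ (1 / p) := by
  have h1 : ∀ x, ‖f x‖ₑ ^ p = ENNReal.ofReal (|f x| ^ p) := fun x => by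
    rw [Real.enorm_eq_ofReal_abs, ENNReal.ofReal_rpow_of_nonneg (abs_nonneg _) hp.le]
  simp only [h1]
  rw [lintegral_rpow_eq_lintegral_meas_lt_mul μ (Eventually.of_forall fun x => abs_nonneg (f x))
    hf.abs.aemeasurable hp, ENNReal.mul_rpow_of_nonneg _ _ (by positivity), lorentzNorm]
  congr 2
  refine setLIntegral_congr_fun measurableSet_Ioi fun t (ht : 0 < t) => ?_
  rw [div_self hp.ne', ENNReal.rpow_one, Real.rpow_sub_one ht.ne']

theorem hasLorentzDuality_self (hp : 1 < p) : HasLorentzDuality μ p p 1 := by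
  have hp0 : 0 < p := zero_lt_one.trans hp
  refine HasLorentzDuality.of_normalized hp0 one_pos fun f hf _ hfn => ?_
  have hI : ∫⁻ x, ‖f x‖ₑ ^ p ∂μ = 1 := by
    rw [lorentzNorm_self hp0 hf] at hfn
    have := congrArg (· ^ p) hfn
    simpa only [← ENNReal.rpow_mul, one_div_mul_cancel hp0.ne', ENNReal.rpow_one,
      ENNReal.one_rpow] using this
  refine ⟨fun x => ‖f x‖ₑ ^ (p - 1), hf.enorm.pow_const _, fun u hu hun => ?_, ?_⟩
  · have hconj := Real.HolderConjugate.conjExponent hp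
    refine (ENNReal.lintegral_mul_le_Lp_mul_Lq μ hconj.symm
      (hf.enorm.pow_const (p - 1)).aemeasurable hu.enorm.aemeasurable).trans ?_
    simp only [← ENNReal.rpow_mul]
    rw [hconj.sub_one_mul_conj, hI, ENNReal.one_rpow, one_mul, ENNReal.ofReal_one,
      ← lorentzNorm_self hp0 hu]
    exact hun
  · rw [ENNReal.ofReal_one, one_mul, ← hI]
    refine le_of_eq (lintegral_congr fun x => ?_)
    exact (ENNReal.rpow_sub_one_mul_self enorm_ne_top hp0).symm

end LorentzDuality

theorem exists_setLIntegral_enorm_le_of_lorentzNorm_le {Ω : Type*} [MeasurableSpace Ω]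
    {μ : Measure Ω} [SFinite μ] {p q : ℝ} (hp : 1 < p) (hq : 1 < q) {D : Set Ω}
    (hD : MeasurableSet D) (hD0 : μ D ≠ 0) (hDt : μ D ≠ ∞) {b : ℝ≥0∞} (hb : b ≠ ∞) :
    ∃ B : ℝ≥0∞, B ≠ ∞ ∧ ∀ u : Ω → ℝ, Measurable u → lorentzNorm μ p q u ≤ b →
      ∫⁻ x in D, ‖u x‖ₑ ∂μ ≤ B := by
  have hp0 : 0 < p := zero_lt_one.trans hp
  have hq0 : 0 < q := zero_lt_one.trans hq
  have hle : ∀ u : Ω → ℝ, lorentzIntegral μ p q u ≤ lorentzNorm μ p q u ^ q := fun u => by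
    rw [lorentzNorm_rpow hq0]
    exact le_mul_of_one_le_left zero_le (ENNReal.one_le_ofReal.2 hp.le)
  obtain ⟨C, hC, hCle⟩ := exists_lintegral_mul_lorentzDual_le hp hq
  set f : Ω → ℝ := D.indicator fun _ => 1 with hf
  have hfm : Measurable f := measurable_const.indicator hD
  have hf1 : ∀ x, |f x| ≤ 1 := fun x => by
    by_cases hx : x ∈ D <;> simp [hf, hx]
  have hsupp : μ {x | f x ≠ 0} ≠ ∞ := ne_top_of_le_ne_top hDt (measure_mono fun x hx => by
    by_contra hxD
    exact hx (indicator_of_notMem hxD _))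
  have hfin : ∀ t : ℝ, 0 < t → μ {x | t < |f x|} ≠ ∞ := fun t ht =>
    ne_top_of_le_ne_top hsupp (measure_mono fun x (hx : t < |f x|) => by
      intro h0
      rw [h0, abs_zero] at hx
      exact absurd hx ht.le.not_gt)
  have hfN := lorentzNorm_ne_top_of_bounded (p := p) (q := q) hp0 hq0 hf1 hsupp
  set k : ℝ≥0∞ := ENNReal.ofReal (1 / (q - 1)) * μ D ^ (q / p - 1) with hk
  have hk0 : k ≠ 0 := mul_ne_zero
    (ENNReal.ofReal_pos.2 (one_div_pos.2 (by linarith))).ne'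
    (ENNReal.rpow_pos (pos_iff_ne_zero.2 hD0) hDt).ne'
  have hkt : k ≠ ∞ := ENNReal.mul_ne_top ENNReal.ofReal_ne_top
    (ENNReal.rpow_ne_top_of_ne_zero hD0 hDt)
  have hdual : ∀ x ∈ D, k ≤ lorentzDual μ p q f x := by
    intro x hx
    have h1 : k = ∫⁻ t in Ioo (0 : ℝ) 1,
        ENNReal.ofReal (t ^ (q - 2)) * μ D ^ (q / p - 1) := by
      rw [lintegral_mul_const _ (by fun_prop), setLIntegral_Ioo_rpow (by linarith) one_pos,
        Real.one_rpow, show q - 2 + 1 = q - 1 by ring]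
    rw [h1, lorentzDual, ← lintegral_indicator measurableSet_Ioo,
      ← lintegral_indicator measurableSet_Ioi]
    refine lintegral_mono fun t => indicator_le (fun t ht => ?_) t
    have hx1 : |f x| = 1 := by rw [hf, indicator_of_mem hx, abs_one]
    have hset : {x | t < |f x|} = D := by
      ext y
      by_cases hy : y ∈ D
      · simp [hf, hy, ht.2]
      · simp [hf, hy, ht.1.le]
    rw [indicator_of_mem (mem_Ioi.2 ht.1),
      indicator_of_mem (s := {t : ℝ | t < |f x|}) (show t < |f x| from hx1 ▸ ht.2), hset]
  refine ⟨ENNReal.ofReal C * (lorentzNorm μ p q f ^ q + b ^ q) / k, ?_, fun u hu hub => ?_⟩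
  · exact ENNReal.div_ne_top (ENNReal.mul_ne_top ENNReal.ofReal_ne_top (ENNReal.add_ne_top.2
      ⟨ENNReal.rpow_ne_top_of_nonneg hq0.le hfN, ENNReal.rpow_ne_top_of_nonneg hq0.le hb⟩)) hk0
  · rw [ENNReal.le_div_iff_mul_le (Or.inl hk0) (Or.inl hkt), ← lintegral_mul_const _ hu.enorm]
    calc ∫⁻ x in D, ‖u x‖ₑ * k ∂μ
        ≤ ∫⁻ x in D, ‖u x‖ₑ * lorentzDual μ p q f x ∂μ :=
          setLIntegral_mono' hD fun x hx => mul_le_mul_right (hdual x hx) _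
      _ ≤ ∫⁻ x, ‖u x‖ₑ * lorentzDual μ p q f x ∂μ := setLIntegral_le_lintegral _ _
      _ ≤ ENNReal.ofReal C * (lorentzIntegral μ p q f + lorentzIntegral μ p q u) :=
          hCle Ω μ f u hfm hu hfin
      _ ≤ _ := by
          gcongr
          · exact hle f
          · exact (hle u).trans (ENNReal.rpow_le_rpow hub hq0.le)

section BesselCapacity

theorem measurable_besselKernel (n : ℕ) (α : ℝ) : Measurable (besselKernel n α) :=
  (measurable_besselDensity n α).ennreal_ofReal.lintegral_prod_right'

theorem lintegral_besselKernel_ne_top (n : ℕ) {α : ℝ} (hα : 0 < α) :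
    ∫⁻ x, besselKernel n α x ≠ ∞ := by
  unfold besselKernel
  rw [lintegral_lintegral (measurable_besselDensity n α).ennreal_ofReal.aemeasurable]
  exact (lt_of_le_of_lt (lintegral_mono fun z => Real.ofReal_le_enorm _)
    (integrable_besselDensity n hα).2).ne

theorem besselKernel_pos (n : ℕ) {α : ℝ} (hα : 0 < α) (x : EuclideanSpace ℝ (Fin n)) :
    0 < besselKernel n α x := by
  have hG := Real.Gamma_pos_of_pos (half_pos hα)
  have hm : Measurable fun t : ℝ => ENNReal.ofReal (besselDensity n α x t) :=
    ((measurable_besselDensity n α).comp measurable_prodMk_left).ennreal_ofReal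
  unfold besselKernel
  rw [setLIntegral_pos_iff hm, inter_eq_right.2]
  · simp
  · intro t (ht : 0 < t)
    refine (ENNReal.ofReal_pos.2 ?_).ne'
    unfold besselDensity
    positivity

variable {n : ℕ} {α s : ℝ}

theorem ENNReal.le_add_rpow_mul_rpow {δ a : ℝ≥0∞} (hδ : δ ≠ 0) (hδt : δ ≠ ∞) (hs : 1 < s) :
    a ≤ δ + δ ^ (1 - s) * a ^ s := by
  rcases le_or_gt a δ with h | h
  · exact le_add_right h
  refine le_add_left ?_
  rcases eq_or_ne a ∞ with rfl | hat
  · rw [ENNReal.top_rpow_of_pos (by linarith), ENNReal.mul_top]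
    exact (ENNReal.rpow_pos (pos_iff_ne_zero.2 hδ) hδt).ne'
  · calc a = a ^ (1 - s) * a ^ s := by
          rw [← ENNReal.rpow_add _ _ (pos_of_gt h).ne' hat, sub_add_cancel, ENNReal.rpow_one]
      _ ≤ δ ^ (1 - s) * a ^ s := by
          gcongr ?_ * _
          rw [← neg_sub s 1, ENNReal.rpow_neg, ENNReal.rpow_neg]
          exact ENNReal.inv_le_inv.2 (ENNReal.rpow_le_rpow h.le (by linarith))

theorem besselCap_ne_zero (hα : 0 < α) (hs : 1 < s) {K : Set (EuclideanSpace ℝ (Fin n))}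
    (hK : IsCompact K) (hK0 : volume K ≠ 0) : besselCap n α s K ≠ 0 := by
  set M := ∫⁻ x, besselKernel n α x with hM
  have hMt : M ≠ ∞ := lintegral_besselKernel_ne_top n hα
  have hGm := measurable_besselKernel n α
  have hV : volume K ≠ ∞ := hK.measure_lt_top.ne
  have hM1 : M + 1 ≠ ∞ := ENNReal.add_ne_top.2 ⟨hMt, ENNReal.one_ne_top⟩
  have hM0 : M + 1 ≠ 0 := by simp
  set δ : ℝ≥0∞ := (2 * (M + 1))⁻¹ with hδ
  have hδ0 : δ ≠ 0 := ENNReal.inv_ne_zero.2 (ENNReal.mul_ne_top ENNReal.ofNat_ne_top hM1)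
  have hδt : δ ≠ ∞ := ENNReal.inv_ne_top.2 (mul_ne_zero two_ne_zero hM0)
  have hδM : δ * M ≤ 2⁻¹ := by
    calc δ * M ≤ δ * (M + 1) := by gcongr; exact le_self_add
      _ = 2⁻¹ := by
        rw [hδ, ENNReal.mul_inv (Or.inl two_ne_zero) (Or.inl ENNReal.ofNat_ne_top), mul_assoc,
          ENNReal.inv_mul_cancel hM0 hM1, mul_one]
  have hYt : δ ^ (1 - s) * M ≠ ∞ := ENNReal.mul_ne_top (ENNReal.rpow_ne_top_of_ne_zero hδ0 hδt) hMt
  have hlow : volume K / 2 / (δ ^ (1 - s) * M) ≤ besselCap n α s K := by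
    refine le_iInf₂ fun f hf => le_iInf fun hfK => ENNReal.div_le_of_le_mul' ?_
    have hG2 : Measurable fun z : EuclideanSpace ℝ (Fin n) × EuclideanSpace ℝ (Fin n) =>
        besselKernel n α (z.1 - z.2) := hGm.comp (measurable_fst.sub measurable_snd)
    have hGx : ∀ x : EuclideanSpace ℝ (Fin n), Measurable fun y => besselKernel n α (x - y) :=
      fun x => hGm.comp (measurable_const.sub measurable_id)
    have h1 : volume K ≤ ∫⁻ x in K, ∫⁻ y, besselKernel n α (x - y) * f y := by
      rw [← setLIntegral_one]
      exact setLIntegral_mono' hK.measurableSet hfK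
    have h2 : ∀ x, ∫⁻ y, besselKernel n α (x - y) * f y ≤
        δ * M + δ ^ (1 - s) * ∫⁻ y, besselKernel n α (x - y) * f y ^ s := by
      intro x
      have hMx : ∫⁻ y, besselKernel n α (x - y) = M := lintegral_sub_left_eq_self _ x
      have hm : Measurable fun y => besselKernel n α (x - y) * f y ^ s :=
        (hGx x).mul (hf.pow_const s)
      rw [← hMx, ← lintegral_const_mul _ (hGx x), ← lintegral_const_mul _ hm,
        ← lintegral_add_left ((hGx x).const_mul _)]
      refine lintegral_mono fun y => ?_
      refine (mul_le_mul_right (ENNReal.le_add_rpow_mul_rpow hδ0 hδt hs) _).trans (le_of_eq ?_)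
      ring
    have h3 : ∫⁻ x in K, ∫⁻ y, besselKernel n α (x - y) * f y ^ s ≤ M * ∫⁻ y, f y ^ s := by
      refine (setLIntegral_le_lintegral _ _).trans (le_of_eq ?_)
      rw [lintegral_lintegral_swap
        (hG2.mul ((hf.pow_const s).comp measurable_snd)).aemeasurable,
        ← lintegral_const_mul _ (hf.pow_const s)]
      refine lintegral_congr fun y => ?_
      have : Measurable fun x => besselKernel n α (x - y) :=
        hGm.comp (measurable_id.sub measurable_const)
      rw [lintegral_mul_const _ this, lintegral_sub_right_eq_self]
    have h4 : volume K ≤ volume K / 2 + δ ^ (1 - s) * M * ∫⁻ y, f y ^ s := by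
      calc volume K
          ≤ ∫⁻ x in K, (δ * M + δ ^ (1 - s) * ∫⁻ y, besselKernel n α (x - y) * f y ^ s) :=
            h1.trans (lintegral_mono fun x => h2 x)
        _ = δ * M * volume K +
            δ ^ (1 - s) * ∫⁻ x in K, ∫⁻ y, besselKernel n α (x - y) * f y ^ s := by
            rw [lintegral_add_left measurable_const, setLIntegral_const,
              lintegral_const_mul' _ _ (ENNReal.rpow_ne_top_of_ne_zero hδ0 hδt)]
        _ ≤ 2⁻¹ * volume K + δ ^ (1 - s) * (M * ∫⁻ y, f y ^ s) := by gcongr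
        _ = _ := by rw [ENNReal.div_eq_inv_mul, mul_assoc]
    nth_rewrite 1 [← ENNReal.add_halves (volume K)] at h4
    exact (ENNReal.add_le_add_iff_left (ENNReal.div_ne_top hV two_ne_zero)).1 h4
  refine (lt_of_lt_of_le (ENNReal.div_pos ?_ hYt) hlow).ne'
  exact (ENNReal.div_pos hK0 ENNReal.ofNat_ne_top).ne'

theorem besselCap_closedBall_ne_top (hα : 0 < α) (hs : 0 < s) (R : ℝ) :
    besselCap n α s (Metric.closedBall 0 R) ≠ ∞ := by
  have hGm := measurable_besselKernel n α
  set B : Set (EuclideanSpace ℝ (Fin n)) := Metric.closedBall 0 1 with hB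
  set c₀ := ∫⁻ z in B, besselKernel n α z with hc₀
  have hc0 : c₀ ≠ 0 := by
    refine ((setLIntegral_pos_iff hGm).2 ?_).ne'
    have hsub : B ⊆ Function.support (besselKernel n α) := fun x _ => (besselKernel_pos n hα x).ne'
    rw [inter_eq_right.2 hsub]
    exact Metric.measure_closedBall_pos volume 0 one_pos
  have hct : c₀ ≠ ∞ := ne_top_of_le_ne_top (lintegral_besselKernel_ne_top n hα)
    (setLIntegral_le_lintegral _ _)
  set f : EuclideanSpace ℝ (Fin n) → ℝ≥0∞ :=
    (Metric.closedBall 0 (R + 1)).indicator fun _ => c₀⁻¹ with hf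
  have hfm : Measurable f := measurable_const.indicator measurableSet_closedBall
  have hfeas : ∀ x ∈ Metric.closedBall (0 : EuclideanSpace ℝ (Fin n)) R,
      1 ≤ ∫⁻ y, besselKernel n α (x - y) * f y := by
    intro x hx
    rw [← lintegral_sub_left_eq_self (fun y => besselKernel n α (x - y) * f y) x]
    simp only [sub_sub_cancel]
    rw [← ENNReal.mul_inv_cancel hc0 hct, hc₀, ← lintegral_mul_const _ hGm,
      ← lintegral_indicator measurableSet_closedBall]
    refine lintegral_mono (indicator_le fun z hz => ?_)
    have hmem : x - z ∈ Metric.closedBall (0 : EuclideanSpace ℝ (Fin n)) (R + 1) := by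
      rw [mem_closedBall_zero_iff] at hx hz ⊢
      exact (norm_sub_le x z).trans (add_le_add hx hz)
    rw [hf, indicator_of_mem hmem]
  refine ne_top_of_le_ne_top ?_ ((iInf₂_le f hfm).trans (iInf_le _ hfeas))
  have : ∀ y, f y ^ s = (Metric.closedBall 0 (R + 1)).indicator (fun _ => c₀⁻¹ ^ s) y := fun y => by
    by_cases hy : y ∈ Metric.closedBall (0 : EuclideanSpace ℝ (Fin n)) (R + 1)
    · rw [hf, indicator_of_mem hy, indicator_of_mem hy]
    · rw [hf, indicator_of_notMem hy, indicator_of_notMem hy, ENNReal.zero_rpow_of_pos hs]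
  simp only [this]
  rw [lintegral_indicator measurableSet_closedBall, setLIntegral_const]
  exact ENNReal.mul_ne_top (ENNReal.rpow_ne_top_of_nonneg hs.le (ENNReal.inv_ne_top.2 hc0))
    (isCompact_closedBall _ _).measure_lt_top.ne

end BesselCapacity

section Multiplier

variable {n : ℕ} {α s p q r : ℝ}

theorem lorentzNorm_indicator_div_le_multiplierNorm (f : EuclideanSpace ℝ (Fin n) →ₘ[volume] ℝ)
    {K : Set (EuclideanSpace ℝ (Fin n))} (hK : IsCompact K) (hK0 : besselCap n α s K ≠ 0) :
    lorentzNorm volume p q (K.indicator f) / besselCap n α s K ^ (1 / r) ≤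
      multiplierNorm n α s p q r f :=
  le_iSup₂_of_le K hK (le_iSup (fun _ : besselCap n α s K ≠ 0 =>
    lorentzNorm volume p q (K.indicator f) / besselCap n α s K ^ (1 / r)) hK0)

theorem lorentzNorm_indicator_le_of_multiplierNorm_le
    {f : EuclideanSpace ℝ (Fin n) →ₘ[volume] ℝ} (hf : multiplierNorm n α s p q r f ≤ 1)
    {K : Set (EuclideanSpace ℝ (Fin n))} (hK : IsCompact K) (hr : 0 < r)
    (hK0 : besselCap n α s K ≠ 0) :
    lorentzNorm volume p q (K.indicator f) ≤ besselCap n α s K ^ (1 / r) := by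
  have h1 : lorentzNorm volume p q (K.indicator f) / besselCap n α s K ^ (1 / r) ≤ 1 :=
    (lorentzNorm_indicator_div_le_multiplierNorm f hK hK0).trans hf
  have h0 : besselCap n α s K ^ (1 / r) ≠ 0 := fun h => hK0
    ((ENNReal.rpow_eq_zero_iff_of_pos (one_div_pos.2 hr)).1 h)
  rwa [ENNReal.div_le_iff_le_mul (Or.inl h0) (Or.inr one_ne_zero), one_mul] at h1

theorem multiplierNorm_smul_le (hp : 0 < p) (hq : 0 < q) {t : ℝ} (ht : 0 < t)
    (f : EuclideanSpace ℝ (Fin n) →ₘ[volume] ℝ) :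
    multiplierNorm n α s p q r (t • f) ≤ ENNReal.ofReal t * multiplierNorm n α s p q r f := by
  refine iSup₂_le fun K hK => iSup_le fun hK0 => ?_
  have h1 : lorentzNorm volume p q (K.indicator (t • f : EuclideanSpace ℝ (Fin n) →ₘ[volume] ℝ)) ≤
      ENNReal.ofReal t * lorentzNorm volume p q (K.indicator f) := by
    rw [← lorentzNorm_const_mul hq ht]
    refine lorentzNorm_mono_ae hp hq ?_
    filter_upwards [AEEqFun.coeFn_smul t f] with x hx
    by_cases hxK : x ∈ K <;> simp [hxK, hx]
  refine (ENNReal.div_le_div_right h1 _).trans ?_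
  rw [mul_div_assoc]
  gcongr
  exact lorentzNorm_indicator_div_le_multiplierNorm f hK hK0

theorem hasDisjointEstimate_multiplierNorm (hp : 1 < p) (hq : 1 < q) (hr : 0 < r) :
    HasDisjointEstimate (multiplierNorm n α s p q r) (lorentzDisjointConst p q) := by
  have hp0 : 0 < p := zero_lt_one.trans hp
  have hq0 : 0 < q := zero_lt_one.trans hq
  classical
  intro A hA u v hu hv
  set κ := lorentzDisjointConst p q with hκ
  have hκt : κ ≠ ∞ := ((lorentzDisjointConst_lt_two hp hq).trans ENNReal.ofNat_lt_top).ne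
  have hκ0 : κ ≠ 0 := (ENNReal.rpow_pos (by norm_num) ENNReal.ofNat_ne_top).ne'
  have hκr : 0 < κ.toReal := ENNReal.toReal_pos hκ0 hκt
  have hm : Measurable (A.piecewise u v) := Measurable.piecewise hA u.measurable v.measurable
  set m : EuclideanSpace ℝ (Fin n) →ₘ[volume] ℝ := AEEqFun.mk _ hm.aestronglyMeasurable with hmdef
  have hcoe : ∀ᵐ x, m x = A.piecewise u v x := AEEqFun.coeFn_mk _ hm.aestronglyMeasurable
  have hmle : multiplierNorm n α s p q r m ≤ κ := by
    refine iSup₂_le fun K hK => iSup_le fun hK0 => ENNReal.div_le_of_le_mul ?_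
    refine lorentzNorm_le_of_disjoint hp0 hq0 (u := K.indicator u) (v := K.indicator v) ?_
      (lorentzNorm_indicator_le_of_multiplierNorm_le hu hK hr hK0)
      (lorentzNorm_indicator_le_of_multiplierNorm_le hv hK hr hK0)
    filter_upwards [hcoe] with x hx
    by_cases hxK : x ∈ K
    · by_cases hxA : x ∈ A <;> simp [hxK, hx, hxA]
    · simp [hxK]
  refine ⟨κ.toReal⁻¹ • m, ?_, ?_⟩
  · refine (multiplierNorm_smul_le hp0 hq0 (inv_pos.2 hκr) m).trans ?_
    rw [ENNReal.ofReal_inv_of_pos hκr, ENNReal.ofReal_toReal hκt]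
    exact (mul_le_mul_right hmle _).trans (ENNReal.inv_mul_cancel hκ0 hκt).le
  · filter_upwards [hcoe, AEEqFun.coeFn_smul κ.toReal⁻¹ m] with x hx hx'
    have hmx : κ * ‖(κ.toReal⁻¹ • m : EuclideanSpace ℝ (Fin n) →ₘ[volume] ℝ) x‖ₑ = ‖m x‖ₑ := by
      have hκe : κ = ‖κ.toReal‖ₑ := by
        rw [Real.enorm_of_nonneg hκr.le, ENNReal.ofReal_toReal hκt]
      rw [hx', Pi.smul_apply, smul_eq_mul]
      nth_rewrite 1 [hκe]
      rw [← enorm_mul, mul_inv_cancel_left₀ hκr.ne']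
    rw [hmx, hx]
    exact ⟨fun h => by rw [piecewise_eq_of_mem _ _ _ h],
      fun h => by rw [piecewise_eq_of_notMem _ _ _ h]⟩

theorem multiplierNorm_le_koetheNorm_koetheNorm (hp : 0 < p) (hq : 0 < q) (hr : 0 < r) {c : ℝ}
    (hc : 0 < c)
    (hdual : HasLorentzDuality (volume : Measure (EuclideanSpace ℝ (Fin n))) p q c)
    (g : EuclideanSpace ℝ (Fin n) →ₘ[volume] ℝ) :
    multiplierNorm n α s p q r g ≤
      ENNReal.ofReal (c ^ 2) * koetheNorm (koetheNorm (multiplierNorm n α s p q r)) g := by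
  refine iSup₂_le fun K hK => iSup_le fun hK0 => ?_
  set C := besselCap n α s K ^ (1 / r) with hC
  rcases eq_or_ne C ∞ with hCt | hCt
  · rw [hCt, ENNReal.div_top]; exact zero_le
  have hC0 : C ≠ 0 := fun h => hK0 ((ENNReal.rpow_eq_zero_iff_of_pos (one_div_pos.2 hr)).1 h)
  refine ENNReal.div_le_of_le_mul ?_
  set b := C.toReal with hb
  have hb0 : 0 < b := ENNReal.toReal_pos hC0 hCt
  have hbC : ENNReal.ofReal b = C := ENNReal.ofReal_toReal hCt
  let E : ℕ → Set (EuclideanSpace ℝ (Fin n)) := fun k => {x | |g x| ≤ k}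
  have hEm : ∀ k, MeasurableSet (E k) := fun k => measurableSet_le g.measurable.abs measurable_const
  refine lorentzNorm_le_of_forall_indicator_le hp hq (E := E)
    (fun i j hij x (hx : |g x| ≤ i) => hx.trans (Nat.cast_le.2 hij))
    (eq_univ_of_forall fun x => mem_iUnion.2 (exists_nat_ge |g x|)) fun k => ?_
  set f := (E k).indicator (K.indicator g) with hf
  have hfm : Measurable f := (g.measurable.indicator hK.measurableSet).indicator (hEm k)
  have hfle : ∀ x, |f x| ≤ k := fun x => by
    by_cases hx : x ∈ E k
    · by_cases hxK : x ∈ K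
      · rw [hf, indicator_of_mem hx, indicator_of_mem hxK]
        exact hx
      · simp [hf, hx, hxK]
    · simp [hf, hx]
  have hfsupp : volume {x | f x ≠ 0} ≠ ∞ := by
    refine ne_top_of_le_ne_top hK.measure_lt_top.ne (measure_mono fun x hx => ?_)
    by_contra hxK
    apply hx
    by_cases hxE : x ∈ E k <;> simp [hf, hxE, hxK]
  obtain ⟨H, hHm, hHu, hHf⟩ :=
    hdual f hfm hfsupp (lorentzNorm_ne_top_of_bounded hp hq hfle hfsupp)
  have hcb : 0 < c * b := mul_pos hc hb0
  have hhm : Measurable fun x => (c * b)⁻¹ * K.indicator H x :=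
    (hHm.indicator hK.measurableSet).const_mul _
  set h : EuclideanSpace ℝ (Fin n) →ₘ[volume] ℝ := AEEqFun.mk _ hhm.aestronglyMeasurable with hh
  have hcoe : ∀ᵐ x, h x = (c * b)⁻¹ * K.indicator H x :=
    AEEqFun.coeFn_mk _ hhm.aestronglyMeasurable
  have hcinv : ENNReal.ofReal (c * b)⁻¹ * ENNReal.ofReal (c * b) = 1 := by
    rw [← ENNReal.ofReal_mul (inv_nonneg.2 hcb.le), inv_mul_cancel₀ hcb.ne', ENNReal.ofReal_one]
  have hpair : ∀ u : EuclideanSpace ℝ (Fin n) → ℝ, ∀ᵐ x, ‖h x‖ₑ * ‖u x‖ₑ =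
      ENNReal.ofReal (c * b)⁻¹ * (‖H x‖ₑ * ‖K.indicator u x‖ₑ) := fun u => by
    filter_upwards [hcoe] with x hx
    rw [hx, enorm_mul, Real.enorm_of_nonneg (inv_nonneg.2 hcb.le), mul_assoc]
    by_cases hxK : x ∈ K <;> simp [hxK]
  have hh1 : koetheNorm (multiplierNorm n α s p q r) h ≤ 1 := by
    refine iSup₂_le fun u hu => ?_
    simp only [ofReal_abs_mul_eq_enorm]
    rw [lintegral_congr_ae (hpair u), lintegral_const_mul' _ _ ENNReal.ofReal_ne_top, ← hcinv]
    gcongr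
    refine (hHu _ (u.measurable.indicator hK.measurableSet)).trans ?_
    rw [ENNReal.ofReal_mul hc.le, hbC]
    gcongr
    exact lorentzNorm_indicator_le_of_multiplierNorm_le hu hK hr hK0
  have hle : ENNReal.ofReal (c * b)⁻¹ * ∫⁻ x, ‖H x‖ₑ * ‖f x‖ₑ ≤
      koetheNorm (koetheNorm (multiplierNorm n α s p q r)) g := by
    refine le_trans ?_ (le_iSup₂_of_le h hh1 le_rfl)
    simp only [ofReal_abs_mul_eq_enorm, mul_comm ‖g _‖ₑ]
    rw [lintegral_congr_ae (hpair g), lintegral_const_mul' _ _ ENNReal.ofReal_ne_top]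
    gcongr with x
    by_cases hxE : x ∈ E k <;> simp [hf, hxE]
  calc lorentzNorm volume p q f ≤ ENNReal.ofReal c * ∫⁻ x, ‖H x‖ₑ * ‖f x‖ₑ := hHf
    _ = ENNReal.ofReal c * ((ENNReal.ofReal (c * b)⁻¹ * ENNReal.ofReal (c * b)) *
          ∫⁻ x, ‖H x‖ₑ * ‖f x‖ₑ) := by rw [hcinv, one_mul]
    _ = ENNReal.ofReal c * ENNReal.ofReal (c * b) *
          (ENNReal.ofReal (c * b)⁻¹ * ∫⁻ x, ‖H x‖ₑ * ‖f x‖ₑ) := by ring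
    _ ≤ ENNReal.ofReal c * ENNReal.ofReal (c * b) *
          koetheNorm (koetheNorm (multiplierNorm n α s p q r)) g := by gcongr
    _ = _ := by
        rw [ENNReal.ofReal_mul hc.le, hbC, pow_two, ENNReal.ofReal_mul hc.le]; ring

theorem koetheDualIso_multiplierNorm (hα : 0 < α) (hs : 1 < s) (hp : 1 < p) (hq : 1 < q)
    (hr : 0 < r) {c : ℝ} (hc : 1 ≤ c)
    (hdual : HasLorentzDuality (volume : Measure (EuclideanSpace ℝ (Fin n))) p q c) :
    KoetheDualIso (multiplierNorm n α s p q r) (multiplierNorm n α s p q r) (c ^ 2) := by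
  have hp0 : 0 < p := zero_lt_one.trans hp
  have hq0 : 0 < q := zero_lt_one.trans hq
  refine (hasDisjointEstimate_multiplierNorm hp hq hr).koetheDualIso
    (lorentzDisjointConst_lt_two hp hq) (fun t ht g => multiplierNorm_smul_le hp0 hq0 ht g)
    (D := fun k : ℕ => Metric.closedBall 0 (k + 1)) (fun k => measurableSet_closedBall)
    (eq_univ_of_forall fun x => ?_) (fun k => ?_) (one_le_pow₀ hc)
    (multiplierNorm_le_koetheNorm_koetheNorm hp0 hq0 hr (zero_lt_one.trans_le hc) hdual)
  · obtain ⟨k, hk⟩ := exists_nat_ge ‖x‖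
    exact mem_iUnion.2 ⟨k, mem_closedBall_zero_iff.2 (hk.trans (by linarith))⟩
  · set D : Set (EuclideanSpace ℝ (Fin n)) := Metric.closedBall 0 (k + 1) with hD
    have hDc : IsCompact D := isCompact_closedBall _ _
    have hD0 : volume D ≠ 0 := (Metric.measure_closedBall_pos volume 0 (by positivity)).ne'
    have hcap0 := besselCap_ne_zero hα hs hDc hD0
    have hcapt : besselCap n α s D ^ (1 / r) ≠ ∞ := ENNReal.rpow_ne_top_of_nonneg (by positivity)
      (besselCap_closedBall_ne_top hα (zero_lt_one.trans hs) _)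
    obtain ⟨B, hB, hBle⟩ := exists_setLIntegral_enorm_le_of_lorentzNorm_le hp hq
      hDc.measurableSet hD0 hDc.measure_lt_top.ne hcapt
    refine ne_top_of_le_ne_top hB (iSup₂_le fun u hu => ?_)
    refine le_trans (le_of_eq ?_) (hBle _ (u.measurable.indicator hDc.measurableSet)
      (lorentzNorm_indicator_le_of_multiplierNorm_le hu hDc hr hcap0))
    rw [← lintegral_indicator hDc.measurableSet]
    refine lintegral_congr fun x => ?_
    by_cases hx : x ∈ D <;> simp [hx]

end Multiplier

theorem theorem1p1 (n : ℕ) (α s p q : ℝ) (hα : 0 < α) (hs : 1 < s) (hsn : s ≤ n / α)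
    (hp : 1 < p) (hq : 1 < q) :
    (∃ c : ℝ, 0 < c ∧ KoetheDualIso (normM n α s p q) (normM n α s p q) c) ∧
    (∃ c : ℝ, 0 < c ∧ KoetheDualIso (normCalM n α s p q) (normCalM n α s p q) c) ∧
    (p = q →
      KoetheDualIso (normM n α s p q) (normM n α s p q) 1 ∧
      KoetheDualIso (normCalM n α s p q) (normCalM n α s p q) 1) := by
  have hp0 : 0 < p := zero_lt_one.trans hp
  have hq0 : 0 < q := zero_lt_one.trans hq
  obtain ⟨c, hc, hdual⟩ :=
    exists_hasLorentzDuality (μ := (volume : Measure (EuclideanSpace ℝ (Fin n)))) hp hq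
  have hc2 : 0 < c ^ 2 := pow_pos (zero_lt_one.trans_le hc) 2
  refine ⟨⟨c ^ 2, hc2, koetheDualIso_multiplierNorm hα hs hp hq hq0 hc hdual⟩,
    ⟨c ^ 2, hc2, koetheDualIso_multiplierNorm hα hs hp hq hp0 hc hdual⟩, ?_⟩
  rintro rfl
  have h1 := koetheDualIso_multiplierNorm (n := n) hα hs hp hp hp0 le_rfl
    (hasLorentzDuality_self hp)
  rw [one_pow] at h1
  exact ⟨h1, h1⟩
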